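/- Let $p\ge 1$ and consider the full model $Y_i = A Z_i$, $i=1,\dots,n$, where $A\in\mathbb{R}^{p\times p}$ is invertible and $Z_1,\dots,Z_n$ are i.i.d. $N(0,I_p)$. Let $y_1,\dots,y_n\in\mathbb{R}^p$ be data whose sample covariance $S_n=\frac1n\sum_{i=1}^n y_iy_i^T$ is nonsingular (so $n\ge p$), and let $V$ be the $n\times p$ matrix with rows $y_i^T$. Let $$f(y,A)=\prod_{i=1}^n (2\pi)^{-p/2}\det(AA^T)^{-1/2}\exp\left(-\tfrac12 y_i^T(AA^T)^{-1}y_i\right)$$ be the likelihood. Let $w=(y_1^T,\dots,y_n^T)^T$ be the stacked data vector, let $\partial w/\partial A$ be the $np\times p^2$ matrix of its partial derivatives with respect to the entries of $A$, the noise $u=(u_1,\dots,u_n)$ in $y_i=Au_i$ being held fixed, and let $J(y,A)=D\left(\frac{\partial w}{\partial A}\big|_{u_i=A^{-1}y_i}\right)$, where for an $np\times p^2$ matrix $M$ either $D(M)=\sqrt{\det(M^TM/n)}$ (the $\ell_2$ norm) or $D(M)=\binom np^{-p}\sum_{I}|\det M_I|$, the sum running over all sets $I$ of $p^2$ rows of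 $M$ (the $\ell_\infty$ norm). Correspondingly let $$C(y)=|\det S_n|^{p/2}\quad\text{or}\quad C(y)=\binom np^{-p}\Big(\sum_{1\le i_1<\dots<i_p\le n}|\det (V)_{(i_1,\dots,i_p)}|\Big)^p ,$$ where $(V)_{(i_1,\dots,i_p)}$ consists of the rows $i_1,\dots,i_p$ of $V$. The generalized fiducial density of $A$ is $r(A\mid y)=J(y,A)f(y,A)\big/\int_{\mathbb{R}^{p\times p}}J(y,A')f(y,A')\,dA'$ (Lebesgue measure on $\mathbb{R}^{p\times p}$). Let $\Gamma_p(a)=\pi^{p(p-1)/4}\prod_{j=1}^p\Gamma\left(a+\tfrac{1-j}2\right)$. Then, under either norm: 1. For every invertible $A$, $f(\cdot,A)$ is the density of the law of $(Y_1,\dots,Y_n)$, and $J(y,A)=C(y)|\det A|^{-p}$. 2. $J(y,\cdot)f(y,\cdot)$ is integrable and $$0<\int_{\mathbb{R}^{p\times p}} J(y,A)f(y,A)\,dA=\frac{\pi^{(p^2-np)/2}\,C(y)\,\Gamma_p(n/2)}{|\det (nS_n)|^{n/2}\,\Gamma_p(p/2)} .$$ 3. For every invertible $A$, $$r(A\mid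 y)=\frac{C(y)(2\pi)^{-np/2}|\det A|^{-(n+p)}\exp\left[-\tfrac12\operatorname{tr}\{nS_n(AA^T)^{-1}\}\right]}{\int_{\mathbb{R}^{p\times p}} J(y,A')f(y,A')\,dA'} .$$ 4. $r(\cdot\mid y)$ is a probability density, and if $A$ has this density then $\Sigma=AA^T$ has the inverse Wishart distribution with $n$ degrees of freedom and scale matrix $nS_n$, that is, the density $$\frac{|\det (nS_n)|^{n/2}}{2^{np/2}\Gamma_p(n/2)}\,(\det\Sigma)^{-(n+p+1)/2}\exp\left[-\tfrac12\operatorname{tr}(nS_n\Sigma^{-1})\right]$$ on the positive definite symmetric matrices, with respect to $\prod_{i\le j}d\sigma_{ij}$. -/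

import Mathlib

open MeasureTheory ProbabilityTheory Matrix
open scoped ENNReal

noncomputable section

namespace Fiducial

/-- The data generating equation `Y_i = A Z_i`, `i = 1, …, n`. -/
def dataGen {n p : ℕ} (A : Matrix (Fin p) (Fin p) ℝ) (z : Fin n → Fin p → ℝ) :
    Fin n → Fin p → ℝ :=
  fun i => A *ᵥ z i

/-- The law of the noise: `Z_1, …, Z_n` are i.i.d. `N(0, I_p)`. -/
def noiseLaw (n p : ℕ) : Measure (Fin n → Fin p → ℝ) :=
  Measure.pi fun _ => Measure.pi fun _ => gaussianReal 0 1

/-- The value of the noise that is recovered from the data `y` and the parameter `A`,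
i.e. `G⁻¹(y, A)`; meaningful for invertible `A`. -/
def noiseInv {n p : ℕ} (y : Fin n → Fin p → ℝ) (A : Matrix (Fin p) (Fin p) ℝ) :
    Fin n → Fin p → ℝ :=
  fun i => A⁻¹ *ᵥ y i

/-- The density of `N(0, S)` on `ℝ^p`. -/
def normalDensity {p : ℕ} (S : Matrix (Fin p) (Fin p) ℝ) (x : Fin p → ℝ) : ℝ :=
  (2 * Real.pi) ^ (-(p : ℝ) / 2) * S.det ^ (-(1 : ℝ) / 2) *
    Real.exp (-(1 / 2) * (x ⬝ᵥ (S⁻¹ *ᵥ x)))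

/-- The likelihood `f(y, A)` of `n` independent observations from `N(0, A Aᵀ)`. -/
def likelihood {n p : ℕ} (y : Fin n → Fin p → ℝ) (A : Matrix (Fin p) (Fin p) ℝ) : ℝ :=
  ∏ i, normalDensity (A * Aᵀ) (y i)

/-- The sample covariance `S_n = (1/n) ∑ y_i y_iᵀ`. -/
def sampleCov {n p : ℕ} (y : Fin n → Fin p → ℝ) : Matrix (Fin p) (Fin p) ℝ :=
  (n : ℝ)⁻¹ • ∑ i, vecMulVec (y i) (y i)

/-- The `np × p²` matrix `∂w/∂A` of partial derivatives of the stacked data vector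
`w = (y_1ᵀ, …, y_nᵀ)ᵀ` with respect to the entries of `A`, for fixed noise `u`. The row with
index `i * p + k` belongs to coordinate `k` of observation `i`; the column with index `j * p + l`
belongs to the entry `a_{jl}`. -/
def dataDeriv {n p : ℕ} (u : Fin n → Fin p → ℝ) (A : Matrix (Fin p) (Fin p) ℝ) :
    Matrix (Fin (n * p)) (Fin (p * p)) ℝ :=
  Matrix.of fun r c =>
    let ik := finProdFinEquiv.symm r
    let jl := finProdFinEquiv.symm c
    deriv (fun t : ℝ => dataGen (A + t • Matrix.single jl.1 jl.2 (1 : ℝ)) u ik.1 ik.2) 0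

/-- The sum of `|det (M)_i|` over all increasing tuples `i_1 < ⋯ < i_q` of rows of `M`. -/
def absMinorSum {N q : ℕ} (M : Matrix (Fin N) (Fin q) ℝ) : ℝ :=
  ∑ s : Fin q ↪o Fin N, |(M.submatrix s id).det|

/-- The two norms for which the Jacobian is considered. -/
inductive NormChoice
  | l2
  | linf

/-- The functional `D` for `np × p²` derivative matrices of `n` observations in dimension `p`.
Under the `ℓ₂` norm it is `√det(MᵀM / n)`. Under the `ℓ_∞` norm it is the sum of the absolute
values of all maximal minors, divided by the number `(n choose p) ^ p` of ways to select, for each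
of the `p` coordinates, `p` of the `n` observations. -/
def jacD (ν : NormChoice) (n p : ℕ) (M : Matrix (Fin (n * p)) (Fin (p * p)) ℝ) : ℝ :=
  match ν with
  | .l2 => √(((n : ℝ)⁻¹ • (Mᵀ * M)).det)
  | .linf => ((n.choose p : ℝ) ^ p)⁻¹ * absMinorSum M

/-- The Jacobian `J(y, A)`: `D` applied to `∂w/∂A` at `u = G⁻¹(y, A)`. -/
def jacobian {n p : ℕ} (ν : NormChoice) (y : Fin n → Fin p → ℝ)
    (A : Matrix (Fin p) (Fin p) ℝ) : ℝ :=
  jacD ν n p (dataDeriv (noiseInv y A) A)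

/-- The Jacobian constant `C(y)`; in the second case `Matrix.of y` is the `n × p` matrix `V` with
rows `y_1ᵀ, …, y_nᵀ`. -/
def jacConst {n p : ℕ} (ν : NormChoice) (y : Fin n → Fin p → ℝ) : ℝ :=
  match ν with
  | .l2 => |(sampleCov y).det| ^ ((p : ℝ) / 2)
  | .linf => ((n.choose p : ℝ) ^ p)⁻¹ * absMinorSum (Matrix.of y) ^ p

/-- The product (that is, Borel) σ-algebra on real matrices. -/
instance matrixMeasurableSpace (p : ℕ) : MeasurableSpace (Matrix (Fin p) (Fin p) ℝ) :=
  inferInstanceAs (MeasurableSpace (Fin p → Fin p → ℝ))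

/-- Lebesgue measure `dA = ∏ da_{ij}` on `ℝ^{p × p}`. -/
def lebesgueMatrix (p : ℕ) : Measure (Matrix (Fin p) (Fin p) ℝ) :=
  (volume : Measure (Fin p → Fin p → ℝ))

/-- The normalizing constant `∫ J(y, A) f(y, A) dA`. -/
def normalizer {n p : ℕ} (ν : NormChoice) (y : Fin n → Fin p → ℝ) : ℝ :=
  ∫ A, jacobian ν y A * likelihood y A ∂lebesgueMatrix p

/-- The generalized fiducial density `r(A | y)` of `A`. -/
def gfDensity {n p : ℕ} (ν : NormChoice) (y : Fin n → Fin p → ℝ)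
    (A : Matrix (Fin p) (Fin p) ℝ) : ℝ :=
  jacobian ν y A * likelihood y A / normalizer ν y

/-- The generalized fiducial distribution of `A`. -/
def gfDistribution {n p : ℕ} (ν : NormChoice) (y : Fin n → Fin p → ℝ) :
    Measure (Matrix (Fin p) (Fin p) ℝ) :=
  (lebesgueMatrix p).withDensity fun A => ENNReal.ofReal (gfDensity ν y A)

/-- The multivariate gamma function `Γ_p(a) = π^{p(p-1)/4} ∏_{j=1}^p Γ(a + (1-j)/2)`. -/
def multiGamma (p : ℕ) (a : ℝ) : ℝ :=
  Real.pi ^ ((p : ℝ) * ((p : ℝ) - 1) / 4) * ∏ j : Fin p, Real.Gamma (a - (j : ℝ) / 2)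

/-- The symmetric matrix with prescribed entries on and above the diagonal. -/
def symOfUpper {p : ℕ} (x : {q : Fin p × Fin p // q.1 ≤ q.2} → ℝ) :
    Matrix (Fin p) (Fin p) ℝ :=
  Matrix.of fun i j => x ⟨(min i j, max i j), min_le_max⟩

/-- Lebesgue measure `∏_{i ≤ j} dσ_{ij}` on the symmetric `p × p` matrices, as a measure on
`ℝ^{p × p}`. -/
def lebesgueSym (p : ℕ) : Measure (Matrix (Fin p) (Fin p) ℝ) :=
  (volume : Measure ({q : Fin p × Fin p // q.1 ≤ q.2} → ℝ)).map symOfUpper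

open Classical in
/-- The density of the inverse Wishart distribution with `m` degrees of freedom and scale matrix
`T`; it vanishes off the positive definite matrices. -/
def invWishartDensity {p : ℕ} (m : ℝ) (T S : Matrix (Fin p) (Fin p) ℝ) : ℝ :=
  if S.PosDef then
    T.det ^ (m / 2) / (2 ^ (m * p / 2) * multiGamma p (m / 2)) *
      S.det ^ (-(m + p + 1) / 2) * Real.exp (-(1 / 2) * (T * S⁻¹).trace)
  else 0

/-- The inverse Wishart distribution with `m` degrees of freedom and scale matrix `T`. -/
def invWishart {p : ℕ} (m : ℝ) (T : Matrix (Fin p) (Fin p) ℝ) :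
    Measure (Matrix (Fin p) (Fin p) ℝ) :=
  (lebesgueSym p).withDensity fun S => ENNReal.ofReal (invWishartDensity m T S)

end Fiducial

end

/-! On GL_p the measure `|det A| ^ (-p) dA` is a two-sided Haar measure. The Jacobian is a constant
times `|det A| ^ (-p)`, and the likelihood depends on `A` only through `Σ = A Aᵀ`, so `J f dA` is
Haar measure times a function of `Σ`. The normalizing constant and the law of `Σ` therefore both
follow from knowing the image of Haar measure under `A ↦ A Aᵀ`.

This image is invariant under `S ↦ G S Gᵀ`, and so is `(det S) ^ (-(p + 1) / 2) dS` on the positive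
definite cone. Since GL_p acts transitively there, the two are proportional;
`lintegral_haarWeight_mul_lintegral` proves this by Fubini. Testing on `(det S) ^ (p / 2) * exp (-tr
S)` fixes the constant in `lintegral_haarWeight_comp_mul_transpose`: one side is a Gaussian integral
over all entries, `π ^ (p² / 2)`, the other is `Γ_p(p / 2)`. The multivariate gamma integral itself
(`lintegral_gammaIntegrand`) goes by induction on `p` with Schur complements. The inverse Wishart
kernel is reduced to it by the substitution `S ↦ S⁻¹`, which preserves the invariant measure, and a
congruence by a square root of `n S_n`.

For the Jacobian, `∂w/∂A` is, up to the order of its rows, block diagonal with `p` copies of `U = V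
A⁻ᵀ`. Its Gram matrix is `I ⊗ UᵀU`, which settles the `ℓ₂` norm. For the `ℓ_∞` norm, a choice of
`p²` rows contributes only if it takes `p` rows from each copy, so the sum of minors of `∂w/∂A` is
the `p`-th power of that of `U` (`absMinorSum_dataDeriv`). -/

namespace Fiducial

/-! ### Multiplicative functions of matrices. -/

/-- A multiplicative function on real matrices is determined by its values on diagonal matrices:
every transvection is conjugate to its own square. -/
theorem monoidHom_eq_det_pow {p : ℕ} (f : Matrix (Fin p) (Fin p) ℝ →* ℝ) (k : ℕ)
    (hf : ∀ d : Fin p → ℝ, f (diagonal d) = (∏ i, d i) ^ k) (M : Matrix (Fin p) (Fin p) ℝ) :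
    f M = M.det ^ k := by
  refine diagonal_transvection_induction (fun M => f M = M.det ^ k) M
    (fun d _ => by rw [hf, det_diagonal]) (fun t => ?_)
    (fun A B hA hB => by rw [map_mul, hA, hB, det_mul, mul_pow])
  obtain ⟨i, j, hij, c⟩ := t
  simp only [TransvectionStruct.toMatrix, det_transvection_of_ne _ _ hij, one_pow]
  -- Invertibility excludes the root 0 of the equation `f T = f T ^ 2` obtained below.
  have h0 : f (transvection i j c) * f (transvection i j (-c)) = 1 := by
    rw [← map_mul, transvection_mul_transvection_same _ _ hij]
    simp
  -- Doubling row `i` and halving column `i` doubles the off-diagonal entry and keeps the diagonal.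
  have h1 : diagonal (Function.update 1 i (2 : ℝ)) * transvection i j c *
      diagonal (Function.update 1 i (2⁻¹ : ℝ)) = transvection i j c * transvection i j c := by
    rw [transvection_mul_transvection_same _ _ hij]
    ext a b
    simp only [transvection, mul_diagonal, diagonal_mul, Matrix.add_apply, single_apply,
      Matrix.one_apply, Function.update_apply, Pi.one_apply]
    grind
  have h2 := congrArg f h1
  rw [map_mul, map_mul, map_mul, hf, hf] at h2
  simp only [Finset.prod_update_of_mem (Finset.mem_univ i), Pi.one_apply, Finset.prod_const_one,
    mul_one] at h2
  have h3 : f (transvection i j c) ≠ 0 := left_ne_zero_of_mul_eq_one h0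
  have h4 : (2 : ℝ) ^ k * (2⁻¹) ^ k = 1 := by rw [← mul_pow]; norm_num
  have h5 : f (transvection i j c) * (f (transvection i j c) - 1) = 0 := by
    linear_combination f (transvection i j c) * h4 - h2
  rcases mul_eq_zero.1 h5 with h | h
  · exact absurd h h3
  · linarith

/-! ### Lebesgue measure on `p × p` matrices: measurability and linear substitutions. -/

instance matrixBorelSpace (p : ℕ) : BorelSpace (Matrix (Fin p) (Fin p) ℝ) :=
  inferInstanceAs (BorelSpace (Fin p → Fin p → ℝ))

instance matrixSecondCountable (p : ℕ) :
    SecondCountableTopology (Matrix (Fin p) (Fin p) ℝ) :=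
  inferInstanceAs (SecondCountableTopology (Fin p → Fin p → ℝ))

instance lebesgueMatrix_sigmaFinite (p : ℕ) : SigmaFinite (lebesgueMatrix p) :=
  inferInstanceAs (SigmaFinite (volume : Measure (Fin p → Fin p → ℝ)))

theorem map_linearMap_lebesgueMatrix {p : ℕ}
    (f : Matrix (Fin p) (Fin p) ℝ →ₗ[ℝ] Matrix (Fin p) (Fin p) ℝ) (hf : LinearMap.det f ≠ 0) :
    (lebesgueMatrix p).map f = ENNReal.ofReal |(LinearMap.det f)⁻¹| • lebesgueMatrix p := by
  have : (volume : Measure (Fin p → Fin p → ℝ)).IsAddHaarMeasure :=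
    Measure.pi.isAddHaarMeasure fun _ : Fin p => (volume : Measure (Fin p → ℝ))
  exact Measure.map_linearMap_addHaar_eq_smul_addHaar
    (volume : Measure (Fin p → Fin p → ℝ)) (f := f) hf

theorem measurable_matrix_mul_left {p : ℕ} (B : Matrix (Fin p) (Fin p) ℝ) :
    Measurable fun A : Matrix (Fin p) (Fin p) ℝ => B * A :=
  (continuous_const.matrix_mul continuous_id).measurable

theorem measurable_matrix_mul_right {p : ℕ} (B : Matrix (Fin p) (Fin p) ℝ) :
    Measurable fun A : Matrix (Fin p) (Fin p) ℝ => A * B :=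
  (continuous_id.matrix_mul continuous_const).measurable

theorem measurable_det (p : ℕ) : Measurable fun A : Matrix (Fin p) (Fin p) ℝ => A.det :=
  continuous_id.matrix_det.measurable

theorem measurable_trace (p : ℕ) : Measurable fun A : Matrix (Fin p) (Fin p) ℝ => A.trace :=
  continuous_id.matrix_trace.measurable

theorem measurable_matrix_inv (p : ℕ) :
    Measurable fun A : Matrix (Fin p) (Fin p) ℝ => A⁻¹ := by
  -- The adjugate formula is valid at singular matrices too: both sides are 0 there.
  have : (fun A : Matrix (Fin p) (Fin p) ℝ => A⁻¹) = fun A => (A.det)⁻¹ • A.adjugate := by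
    ext1 A
    rw [Matrix.inv_def, Ring.inverse_eq_inv']
  rw [this]
  exact (measurable_det p).inv.smul continuous_id.matrix_adjugate.measurable

theorem measurable_mul_transpose_self (p : ℕ) :
    Measurable fun A : Matrix (Fin p) (Fin p) ℝ => A * Aᵀ :=
  (continuous_id.matrix_mul continuous_id.matrix_transpose).measurable

/-- Positive semidefiniteness is an intersection of closed conditions, so the uncountable
intersection over `x` is harmless; nonsingularity then cuts out an open set. -/
theorem measurableSet_posDef (p : ℕ) :
    MeasurableSet {S : Matrix (Fin p) (Fin p) ℝ | S.PosDef} := by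
  have h : {S : Matrix (Fin p) (Fin p) ℝ | S.PosDef} =
      {S | Sᵀ = S} ∩ (⋂ x : Fin p → ℝ, {S | 0 ≤ x ⬝ᵥ (S *ᵥ x)}) ∩ {S | S.det ≠ 0} := by
    ext S
    have h1 : S.PosSemidef ↔ Sᵀ = S ∧ ∀ x : Fin p → ℝ, 0 ≤ x ⬝ᵥ (S *ᵥ x) := by
      rw [posSemidef_iff_dotProduct_mulVec]
      simp [Matrix.IsHermitian, conjTranspose_eq_transpose_of_trivial]
    simp only [Set.mem_inter_iff, Set.mem_iInter, Set.mem_ofPred_eq, ← h1]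
    exact ⟨fun h => ⟨h.posSemidef, h.det_pos.ne'⟩, fun h => h.1.posDef_iff_det_ne_zero.2 h.2⟩
  rw [h]
  refine (MeasurableSet.inter ?_ ?_).inter ?_
  · exact (isClosed_eq continuous_id.matrix_transpose continuous_id).measurableSet
  · refine (isClosed_iInter fun x => ?_).measurableSet
    exact isClosed_le continuous_const
      (continuous_const.dotProduct (continuous_id.matrix_mulVec continuous_const))
  · exact (isOpen_ne_fun continuous_id.matrix_det continuous_const).measurableSet

/-- Right multiplication acts on each of the `p` rows separately through `Bᵀ`, so its determinant is
`det B ^ p`. -/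
theorem map_mul_right_lebesgueMatrix {p : ℕ} {B : Matrix (Fin p) (Fin p) ℝ} (hB : B.det ≠ 0) :
    (lebesgueMatrix p).map (fun A => A * B) =
      ENNReal.ofReal ((|B.det| ^ p)⁻¹) • lebesgueMatrix p := by
  let f : (Fin p → Fin p → ℝ) →ₗ[ℝ] (Fin p → Fin p → ℝ) :=
    LinearMap.pi fun i => (toLin' Bᵀ).comp (LinearMap.proj i)
  have hdet : LinearMap.det f = B.det ^ p := by
    rw [LinearMap.det_pi]
    simp
  have hf : LinearMap.mulRight ℝ B = f := by
    ext A i j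
    exact congrFun (mulVec_transpose B (A i)).symm j
  have := map_linearMap_lebesgueMatrix (LinearMap.mulRight ℝ B)
    (by rw [hf]; exact hdet.trans_ne (pow_ne_zero _ hB))
  rw [hf] at this
  erw [hdet] at this
  rw [abs_inv, abs_pow] at this
  rw [← this, ← hf]
  rfl

/-- A linear involution has determinant `±1`. This transfers the right-hand case to left
multiplication. -/
theorem map_transpose_lebesgueMatrix (p : ℕ) :
    (lebesgueMatrix p).map transpose = lebesgueMatrix p := by
  let f : Matrix (Fin p) (Fin p) ℝ →ₗ[ℝ] Matrix (Fin p) (Fin p) ℝ :=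
    (transposeLinearEquiv (Fin p) (Fin p) ℝ ℝ).toLinearMap
  have hdet : LinearMap.det f * LinearMap.det f = 1 := by
    rw [← LinearMap.det_comp, show f.comp f = LinearMap.id from rfl, LinearMap.det_id]
  have h1 : |LinearMap.det f| = 1 := by
    rcases mul_self_eq_one_iff.1 hdet with h | h <;> simp [h]
  have := map_linearMap_lebesgueMatrix f (left_ne_zero_of_mul_eq_one hdet)
  rw [abs_inv, h1, inv_one, ENNReal.ofReal_one, one_smul] at this
  exact this

theorem map_mul_left_lebesgueMatrix {p : ℕ} {B : Matrix (Fin p) (Fin p) ℝ} (hB : B.det ≠ 0) :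
    (lebesgueMatrix p).map (fun A => B * A) =
      ENNReal.ofReal ((|B.det| ^ p)⁻¹) • lebesgueMatrix p := by
  have ht : Measurable (transpose : Matrix (Fin p) (Fin p) ℝ → _) :=
    continuous_id.matrix_transpose.measurable
  have h : (fun A : Matrix (Fin p) (Fin p) ℝ => B * A) =
      transpose ∘ (fun A => A * Bᵀ) ∘ transpose := by
    ext1 A
    simp [transpose_mul]
  rw [h, ← Measure.map_map ht ((measurable_matrix_mul_right _).comp ht),
    ← Measure.map_map (measurable_matrix_mul_right _) ht, map_transpose_lebesgueMatrix,
    map_mul_right_lebesgueMatrix (by rwa [det_transpose]), Measure.map_smul,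
    map_transpose_lebesgueMatrix, det_transpose]

/-! ### Haar measure on GL_p. -/

/-- The density `|det A| ^ (-p)` of the Haar measure on `GL_p` with respect to `dA`. -/
noncomputable def haarWeight {p : ℕ} (A : Matrix (Fin p) (Fin p) ℝ) : ℝ≥0∞ :=
  ENNReal.ofReal ((|A.det| ^ p)⁻¹)

theorem measurable_haarWeight (p : ℕ) : Measurable (haarWeight (p := p)) :=
  (((measurable_det p).abs.pow_const p).inv).ennreal_ofReal

/-- By the convention `0⁻¹ = 0` the weight vanishes on singular matrices, so integrals need not be
restricted to GL_p. For `p = 0` the determinant is 1. -/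
theorem haarWeight_eq_zero {p : ℕ} {A : Matrix (Fin p) (Fin p) ℝ} (hA : A.det = 0) :
    haarWeight A = 0 := by
  rcases Nat.eq_zero_or_pos p with rfl | hp
  · simp at hA
  · simp [haarWeight, hA, hp.ne']

theorem haarWeight_mul {p : ℕ} (A B : Matrix (Fin p) (Fin p) ℝ) :
    haarWeight (A * B) = haarWeight A * haarWeight B := by
  rw [haarWeight, det_mul, abs_mul, mul_pow, mul_inv, ENNReal.ofReal_mul (by positivity)]
  rfl

theorem haarWeight_ne_zero {p : ℕ} {A : Matrix (Fin p) (Fin p) ℝ} (hA : A.det ≠ 0) :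
    haarWeight A ≠ 0 := by
  rw [haarWeight, ne_eq, ENNReal.ofReal_eq_zero, not_le]
  positivity

/-- The factor by which `A ↦ A * B` scales Lebesgue measure is exactly `haarWeight B`, which is
nonzero and finite and cancels. -/
theorem lintegral_haarWeight_mul_right {p : ℕ} {F : Matrix (Fin p) (Fin p) ℝ → ℝ≥0∞}
    (hF : Measurable F) {B : Matrix (Fin p) (Fin p) ℝ} (hB : B.det ≠ 0) :
    ∫⁻ A, haarWeight A * F (A * B) ∂lebesgueMatrix p =
      ∫⁻ A, haarWeight A * F A ∂lebesgueMatrix p := by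
  have h := lintegral_map (μ := lebesgueMatrix p) ((measurable_haarWeight p).mul hF)
    (measurable_matrix_mul_right B)
  rw [map_mul_right_lebesgueMatrix hB, lintegral_smul_measure] at h
  have hm : Measurable fun A => haarWeight A * F (A * B) :=
    (measurable_haarWeight p).mul (hF.comp (measurable_matrix_mul_right B))
  simp only [Pi.mul_apply, haarWeight_mul, mul_comm _ (haarWeight B), mul_assoc] at h
  rw [lintegral_const_mul _ hm, smul_eq_mul] at h
  exact ((ENNReal.mul_right_inj (haarWeight_ne_zero hB) ENNReal.ofReal_ne_top).1 h).symm

theorem lintegral_haarWeight_mul_left {p : ℕ} {F : Matrix (Fin p) (Fin p) ℝ → ℝ≥0∞}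
    (hF : Measurable F) {B : Matrix (Fin p) (Fin p) ℝ} (hB : B.det ≠ 0) :
    ∫⁻ A, haarWeight A * F (B * A) ∂lebesgueMatrix p =
      ∫⁻ A, haarWeight A * F A ∂lebesgueMatrix p := by
  have h := lintegral_map (μ := lebesgueMatrix p) ((measurable_haarWeight p).mul hF)
    (measurable_matrix_mul_left B)
  rw [map_mul_left_lebesgueMatrix hB, lintegral_smul_measure] at h
  have hm : Measurable fun A => haarWeight A * F (B * A) :=
    (measurable_haarWeight p).mul (hF.comp (measurable_matrix_mul_left B))
  simp only [Pi.mul_apply, haarWeight_mul, mul_assoc] at h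
  rw [lintegral_const_mul _ hm, smul_eq_mul] at h
  exact ((ENNReal.mul_right_inj (haarWeight_ne_zero hB) ENNReal.ofReal_ne_top).1 h).symm

/-! ### Symmetric matrices and their congruences. -/

theorem symOfUpper_transpose {p : ℕ} (x : {q : Fin p × Fin p // q.1 ≤ q.2} → ℝ) :
    (symOfUpper x)ᵀ = symOfUpper x := by
  ext i j
  simp only [symOfUpper, transpose_apply, of_apply, min_comm, max_comm]

theorem symOfUpper_upper {p : ℕ} {S : Matrix (Fin p) (Fin p) ℝ} (hS : Sᵀ = S) :
    symOfUpper (fun q => S q.1.1 q.1.2) = S := by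
  ext i j
  simp only [symOfUpper, of_apply]
  rcases le_total i j with h | h
  · rw [min_eq_left h, max_eq_right h]
  · rw [min_eq_right h, max_eq_left h, ← transpose_apply S, hS]

theorem symOfUpper_apply_le {p : ℕ} (x : {q : Fin p × Fin p // q.1 ≤ q.2} → ℝ)
    (q : {q : Fin p × Fin p // q.1 ≤ q.2}) : symOfUpper x q.1.1 q.1.2 = x q := by
  simp only [symOfUpper, of_apply]
  congr 1
  ext1
  exact Prod.ext (min_eq_left q.2) (max_eq_right q.2)

theorem measurable_symOfUpper (p : ℕ) : Measurable (symOfUpper (p := p)) :=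
  measurable_pi_lambda _ fun _ => measurable_pi_lambda _ fun _ => measurable_pi_apply _

/-- The action `S ↦ G S Gᵀ` on symmetric matrices, in the coordinates on and above the diagonal. -/
noncomputable def symCongr (p : ℕ) : Matrix (Fin p) (Fin p) ℝ →*
    (({q : Fin p × Fin p // q.1 ≤ q.2} → ℝ) →ₗ[ℝ] ({q : Fin p × Fin p // q.1 ≤ q.2} → ℝ)) where
  toFun G :=
    { toFun := fun x q => (G * symOfUpper x * Gᵀ) q.1.1 q.1.2
      map_add' := fun x y => by
        have : symOfUpper (x + y) = symOfUpper x + symOfUpper y := rfl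
        ext q
        rw [this, Matrix.mul_add, Matrix.add_mul]
        rfl
      map_smul' := fun c x => by
        have : symOfUpper (c • x) = c • symOfUpper x := rfl
        ext q
        rw [this, Matrix.mul_smul, Matrix.smul_mul]
        rfl }
  map_one' := by
    refine LinearMap.ext fun x => funext fun q => ?_
    simpa using symOfUpper_apply_le x q
  map_mul' G H := by
    refine LinearMap.ext fun x => funext fun q => ?_
    change _ = (G * symOfUpper (fun q : {q : Fin p × Fin p // q.1 ≤ q.2} =>
      (H * symOfUpper x * Hᵀ) q.1.1 q.1.2) * Gᵀ) q.1.1 q.1.2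
    rw [symOfUpper_upper]
    · change (G * H * symOfUpper x * (G * H)ᵀ) q.1.1 q.1.2 = _
      rw [transpose_mul]
      simp only [Matrix.mul_assoc]
    · simp only [transpose_mul, transpose_transpose, symOfUpper_transpose, Matrix.mul_assoc]

theorem symOfUpper_symCongr {p : ℕ} (G : Matrix (Fin p) (Fin p) ℝ)
    (x : {q : Fin p × Fin p // q.1 ≤ q.2} → ℝ) :
    symOfUpper (symCongr p G x) = G * symOfUpper x * Gᵀ :=
  symOfUpper_upper (S := G * symOfUpper x * Gᵀ) (by
    simp only [transpose_mul, transpose_transpose, symOfUpper_transpose, Matrix.mul_assoc])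

/-- With indices from 0, `d i` occurs `p - i` times as first factor and `i + 1` times as second, `p
+ 1` times in all. -/
theorem prod_upper_mul {p : ℕ} (d : Fin p → ℝ) :
    ∏ q : {q : Fin p × Fin p // q.1 ≤ q.2}, (d q.1.1 * d q.1.2) = (∏ i, d i) ^ (p + 1) := by
  rw [Finset.prod_mul_distrib]
  have h1 : ∏ q : {q : Fin p × Fin p // q.1 ≤ q.2}, d q.1.1 = ∏ i : Fin p, d i ^ (p - (i : ℕ)) := by
    rw [← Finset.prod_subtype (Finset.univ.filter fun q : Fin p × Fin p => q.1 ≤ q.2) (by simp)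
      (fun q => d q.1), Finset.prod_filter, Fintype.prod_prod_type]
    refine Finset.prod_congr rfl fun i _ => ?_
    rw [← Finset.prod_filter]
    dsimp only
    rw [Finset.prod_const, ← Fin.card_Ici]
    congr 2
    ext j
    simp
  have h2 : ∏ q : {q : Fin p × Fin p // q.1 ≤ q.2}, d q.1.2 = ∏ i : Fin p, d i ^ ((i : ℕ) + 1) := by
    rw [← Finset.prod_subtype (Finset.univ.filter fun q : Fin p × Fin p => q.1 ≤ q.2) (by simp)
      (fun q => d q.2), Finset.prod_filter, Fintype.prod_prod_type_right]
    refine Finset.prod_congr rfl fun i _ => ?_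
    rw [← Finset.prod_filter]
    dsimp only
    rw [Finset.prod_const, ← Fin.card_Iic]
    congr 2
    ext j
    simp
  rw [h1, h2, ← Finset.prod_mul_distrib, ← Finset.prod_pow]
  refine Finset.prod_congr rfl fun i _ => ?_
  rw [← pow_add]
  congr 1
  omega

/-- By multiplicativity only diagonal `G` matter, and these scale the coordinate `(i, j)` by `d i *
d j`. -/
theorem det_symCongr {p : ℕ} (G : Matrix (Fin p) (Fin p) ℝ) :
    LinearMap.det (symCongr p G) = G.det ^ (p + 1) := by
  refine monoidHom_eq_det_pow (LinearMap.det.comp (symCongr p)) (p + 1) (fun d => ?_) G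
  have : symCongr p (diagonal d) = toLin' (diagonal fun q => d q.1.1 * d q.1.2) := by
    refine LinearMap.ext fun x => funext fun q => ?_
    simp only [symCongr, MonoidHom.coe_mk, OneHom.coe_mk, LinearMap.coe_mk, AddHom.coe_mk,
      diagonal_transpose, mul_diagonal, diagonal_mul, symOfUpper_apply_le, toLin'_apply,
      mulVec_diagonal]
    ring
  rw [MonoidHom.comp_apply, this, LinearMap.det_toLin', det_diagonal, prod_upper_mul]

theorem measurable_congr {p : ℕ} (G : Matrix (Fin p) (Fin p) ℝ) :
    Measurable fun S : Matrix (Fin p) (Fin p) ℝ => G * S * Gᵀ :=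
  ((continuous_const.matrix_mul continuous_id).matrix_mul continuous_const).measurable

theorem map_congr_lebesgueSym {p : ℕ} {G : Matrix (Fin p) (Fin p) ℝ} (hG : G.det ≠ 0) :
    (lebesgueSym p).map (fun S => G * S * Gᵀ) =
      ENNReal.ofReal ((|G.det| ^ (p + 1))⁻¹) • lebesgueSym p := by
  have h1 : (fun S => G * S * Gᵀ) ∘ symOfUpper (p := p) = symOfUpper ∘ symCongr p G :=
    funext fun x => (symOfUpper_symCongr G x).symm
  have h2 : Measurable (symCongr p G) :=
    (LinearMap.continuous_of_finiteDimensional _).measurable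
  rw [lebesgueSym, Measure.map_map (measurable_congr G) (measurable_symOfUpper p), h1,
    ← Measure.map_map (measurable_symOfUpper p) h2, Real.map_linearMap_volume_pi_eq_smul_volume_pi
      (by rw [det_symCongr]; exact pow_ne_zero _ hG), Measure.map_smul, det_symCongr, abs_inv,
    abs_pow]

theorem posDef_congr_iff {p : ℕ} {G S : Matrix (Fin p) (Fin p) ℝ} (hG : G.det ≠ 0) :
    (G * S * Gᵀ).PosDef ↔ S.PosDef := by
  have := Matrix.IsUnit.posDef_star_right_conjugate_iff (x := S)
    ((isUnit_iff_isUnit_det G).2 hG.isUnit)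
  rwa [star_eq_conjTranspose, conjTranspose_eq_transpose_of_trivial] at this

/-! ### The invariant measure on the positive definite cone and its uniqueness. -/

open Classical in
/-- The density `(det S) ^ (-(p + 1) / 2)` of the invariant measure on positive definite
matrices. -/
noncomputable def invDensity {p : ℕ} (S : Matrix (Fin p) (Fin p) ℝ) : ℝ≥0∞ :=
  if S.PosDef then ENNReal.ofReal (S.det ^ (-((p : ℝ) + 1) / 2)) else 0

/-- The measure `(det S) ^ (-(p + 1) / 2) dS` on positive definite matrices, which is invariant
under `S ↦ G S Gᵀ`. -/
noncomputable def invMeasure (p : ℕ) : Measure (Matrix (Fin p) (Fin p) ℝ) :=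
  (lebesgueSym p).withDensity invDensity

theorem measurable_invDensity (p : ℕ) : Measurable (invDensity (p := p)) :=
  Measurable.ite (measurableSet_posDef p) ((measurable_det p).pow_const _).ennreal_ofReal
    measurable_const

instance lebesgueSym_sFinite (p : ℕ) : SFinite (lebesgueSym p) := by
  unfold lebesgueSym
  infer_instance

instance invMeasure_sFinite (p : ℕ) : SFinite (invMeasure p) := by
  unfold invMeasure
  infer_instance

theorem ae_invMeasure_posDef (p : ℕ) : ∀ᵐ S ∂invMeasure p, S.PosDef := by
  rw [invMeasure, ae_withDensity_iff (measurable_invDensity p)]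
  refine .of_forall fun S hS => ?_
  by_contra h
  exact hS (if_neg h)

/-- The exponent is chosen so that this factor is the one in `map_congr_lebesgueSym`; hence the
invariance of `invMeasure`. -/
theorem invDensity_congr {p : ℕ} {G : Matrix (Fin p) (Fin p) ℝ} (hG : G.det ≠ 0)
    (S : Matrix (Fin p) (Fin p) ℝ) :
    invDensity (G * S * Gᵀ) = ENNReal.ofReal ((|G.det| ^ (p + 1))⁻¹) * invDensity S := by
  by_cases h : S.PosDef
  · rw [invDensity, invDensity, if_pos h, if_pos ((posDef_congr_iff hG).2 h),
      ← ENNReal.ofReal_mul (by positivity), det_mul, det_mul, det_transpose]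
    congr 1
    have hd := h.det_pos
    have hG' : 0 < |G.det| := abs_pos.2 hG
    rw [show G.det * S.det * G.det = |G.det| ^ 2 * S.det by rw [sq_abs]; ring,
      Real.mul_rpow (by positivity) hd.le]
    congr 1
    rw [← Real.rpow_natCast, ← Real.rpow_natCast, ← Real.rpow_mul hG'.le, ← Real.rpow_neg hG'.le]
    congr 1
    push_cast
    ring
  · rw [invDensity, invDensity, if_neg h, if_neg (mt (posDef_congr_iff hG).1 h), mul_zero]

theorem lintegral_invMeasure_congr {p : ℕ} {G : Matrix (Fin p) (Fin p) ℝ} (hG : G.det ≠ 0)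
    {F : Matrix (Fin p) (Fin p) ℝ → ℝ≥0∞} (hF : Measurable F) :
    ∫⁻ S, F (G * S * Gᵀ) ∂invMeasure p = ∫⁻ S, F S ∂invMeasure p := by
  have hm : Measurable fun S => invDensity S * F (G * S * Gᵀ) :=
    (measurable_invDensity p).mul (hF.comp (measurable_congr G))
  have h := lintegral_map (μ := lebesgueSym p) ((measurable_invDensity p).mul hF)
    (measurable_congr G)
  rw [map_congr_lebesgueSym hG, lintegral_smul_measure] at h
  simp only [Pi.mul_apply, invDensity_congr hG, mul_assoc (ENNReal.ofReal _)] at h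
  rw [lintegral_const_mul _ hm, smul_eq_mul] at h
  have e := lintegral_withDensity_eq_lintegral_mul (lebesgueSym p) (measurable_invDensity p)
    (hF.comp (measurable_congr G))
  rw [invMeasure, lintegral_withDensity_eq_lintegral_mul _ (measurable_invDensity p) hF]
  refine e.trans ?_
  refine ((ENNReal.mul_right_inj ?_ ENNReal.ofReal_ne_top).1 h).symm
  rw [ne_eq, ENNReal.ofReal_eq_zero, not_le]
  positivity

theorem PosDef.exists_eq_mul_transpose {p : ℕ} {S : Matrix (Fin p) (Fin p) ℝ} (hS : S.PosDef) :
    ∃ B : Matrix (Fin p) (Fin p) ℝ, B.det ≠ 0 ∧ S = B * Bᵀ := by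
  open scoped MatrixOrder in
  obtain ⟨B, hB⟩ := CStarAlgebra.nonneg_iff_eq_mul_star_self.mp hS.posSemidef.nonneg
  rw [star_eq_conjTranspose, conjTranspose_eq_transpose_of_trivial] at hB
  refine ⟨B, fun h => hS.det_pos.ne' ?_, hB⟩
  rw [hB, det_mul, h, zero_mul]

/-- With `S = B Bᵀ`, the matrix `B` is absorbed into `A` by right invariance. -/
theorem lintegral_haarWeight_congr_mul_transpose {p : ℕ}
    {h : Matrix (Fin p) (Fin p) ℝ → ℝ≥0∞} (hh : Measurable h) {S : Matrix (Fin p) (Fin p) ℝ}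
    (hS : S.PosDef) :
    ∫⁻ A, haarWeight A * h (A * S * Aᵀ) ∂lebesgueMatrix p =
      ∫⁻ A, haarWeight A * h (A * Aᵀ) ∂lebesgueMatrix p := by
  obtain ⟨B, hB, rfl⟩ := PosDef.exists_eq_mul_transpose hS
  have := lintegral_haarWeight_mul_right (hh.comp (measurable_mul_transpose_self p)) hB
  simpa only [Function.comp_apply, transpose_mul, Matrix.mul_assoc] using this

/-- Here `A⁻¹ B = (B⁻¹ A)⁻¹`, so left invariance is what is needed; this is where Haar measure must
be two-sided. -/
theorem lintegral_haarWeight_congr_inv {p : ℕ}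
    {g : Matrix (Fin p) (Fin p) ℝ → ℝ≥0∞} (hg : Measurable g) {S : Matrix (Fin p) (Fin p) ℝ}
    (hS : S.PosDef) :
    ∫⁻ A, haarWeight A * g (A⁻¹ * S * (A⁻¹)ᵀ) ∂lebesgueMatrix p =
      ∫⁻ A, haarWeight A * g (A⁻¹ * (A⁻¹)ᵀ) ∂lebesgueMatrix p := by
  obtain ⟨B, hB, rfl⟩ := PosDef.exists_eq_mul_transpose hS
  refine Eq.trans ?_ (lintegral_haarWeight_mul_left (hg.comp
    ((measurable_mul_transpose_self p).comp (measurable_matrix_inv p)))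
    (B := B⁻¹) (by simpa using hB))
  refine lintegral_congr fun A => ?_
  simp only [Function.comp_apply]
  rw [Matrix.mul_inv_rev, Matrix.nonsing_inv_nonsing_inv _ hB.isUnit]
  simp only [transpose_mul, Matrix.mul_assoc]

theorem measurable_congr_pair (p : ℕ) :
    Measurable fun q : Matrix (Fin p) (Fin p) ℝ × Matrix (Fin p) (Fin p) ℝ =>
      q.1 * q.2 * q.1ᵀ :=
  ((continuous_fst.matrix_mul continuous_snd).matrix_mul
    continuous_fst.matrix_transpose).measurable

theorem measurable_mul_mul_transpose {p : ℕ} (S : Matrix (Fin p) (Fin p) ℝ) :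
    Measurable fun A : Matrix (Fin p) (Fin p) ℝ => A * S * Aᵀ :=
  ((continuous_id.matrix_mul continuous_const).matrix_mul
    continuous_id.matrix_transpose).measurable

theorem inv_congr_congr {p : ℕ} {A : Matrix (Fin p) (Fin p) ℝ} (hA : A.det ≠ 0)
    (S : Matrix (Fin p) (Fin p) ℝ) : A⁻¹ * (A * S * Aᵀ) * A⁻¹ᵀ = S := by
  rw [Matrix.mul_assoc A, nonsing_inv_mul_cancel_left _ _ (Ne.isUnit hA), transpose_nonsing_inv,
    mul_nonsing_inv_cancel_right]
  rw [det_transpose]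
  exact Ne.isUnit hA

/-- Uniqueness of the invariant measure on the cone of positive definite matrices. -/
theorem lintegral_haarWeight_mul_lintegral {p : ℕ} (μ : Measure (Matrix (Fin p) (Fin p) ℝ))
    [SFinite μ] (hμ : ∀ᵐ S ∂μ, S.PosDef)
    (hinv : ∀ G : Matrix (Fin p) (Fin p) ℝ, G.det ≠ 0 → ∀ F : Matrix (Fin p) (Fin p) ℝ → ℝ≥0∞,
      Measurable F → ∫⁻ S, F (G * S * Gᵀ) ∂μ = ∫⁻ S, F S ∂μ)
    {h g : Matrix (Fin p) (Fin p) ℝ → ℝ≥0∞} (hh : Measurable h) (hg : Measurable g) :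
    (∫⁻ A, haarWeight A * h (A * Aᵀ) ∂lebesgueMatrix p) * ∫⁻ S, g S ∂μ =
      (∫⁻ A, haarWeight A * g (A⁻¹ * (A⁻¹)ᵀ) ∂lebesgueMatrix p) * ∫⁻ S, h S ∂μ := by
  -- Two double integrals over `(S, A)`. Integrated in `A` first, the inner integral does not see
  -- the congruence by `S`, which yields the two products of the statement.
  let f₁ : Matrix (Fin p) (Fin p) ℝ → Matrix (Fin p) (Fin p) ℝ → ℝ≥0∞ :=
    fun S A => haarWeight A * h (A * S * Aᵀ) * g S
  let f₂ : Matrix (Fin p) (Fin p) ℝ → Matrix (Fin p) (Fin p) ℝ → ℝ≥0∞ :=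
    fun S A => haarWeight A * g (A⁻¹ * S * (A⁻¹)ᵀ) * h S
  have hf₁ : Measurable (Function.uncurry f₁) :=
    (((measurable_haarWeight p).comp measurable_snd).mul
      (hh.comp ((measurable_congr_pair p).comp measurable_swap))).mul (hg.comp measurable_fst)
  have hf₂ : Measurable (Function.uncurry f₂) :=
    (((measurable_haarWeight p).comp measurable_snd).mul
      (hg.comp ((measurable_congr_pair p).comp
        (((measurable_matrix_inv p).comp measurable_snd).prodMk measurable_fst)))).mul
      (hh.comp measurable_fst)
  have e₁ : ∀ᵐ S ∂μ, (∫⁻ A, haarWeight A * h (A * Aᵀ) ∂lebesgueMatrix p) * g S =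
      ∫⁻ A, f₁ S A ∂lebesgueMatrix p := by
    filter_upwards [hμ] with S hS
    rw [← lintegral_haarWeight_congr_mul_transpose hh hS, lintegral_mul_const]
    exact (measurable_haarWeight p).mul (hh.comp (measurable_mul_mul_transpose S))
  have e₂ : ∀ᵐ S ∂μ, (∫⁻ A, haarWeight A * g (A⁻¹ * (A⁻¹)ᵀ) ∂lebesgueMatrix p) * h S =
      ∫⁻ A, f₂ S A ∂lebesgueMatrix p := by
    filter_upwards [hμ] with S hS
    rw [← lintegral_haarWeight_congr_inv hg hS, lintegral_mul_const]
    exact (measurable_haarWeight p).mul (hg.comp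
      ((measurable_mul_mul_transpose S).comp (measurable_matrix_inv p)))
  rw [← lintegral_const_mul _ hg, ← lintegral_const_mul _ hh, lintegral_congr_ae e₁,
    lintegral_congr_ae e₂, lintegral_lintegral_swap hf₁.aemeasurable,
    lintegral_lintegral_swap hf₂.aemeasurable]
  refine lintegral_congr fun A => ?_
  by_cases hA : A.det = 0
  · simp [f₁, f₂, haarWeight_eq_zero hA]
  · have hm : Measurable fun S => f₂ S A := hf₂.of_uncurry_right
    -- For fixed invertible `A`, replacing `S` by `A S Aᵀ` in `f₂` gives `f₁`.
    rw [← hinv A hA _ hm]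
    refine lintegral_congr fun S => ?_
    simp only [f₁, f₂, inv_congr_congr hA]
    ring

/-! ### Product measures, Gaussian integrals, and the null set of singular matrices. -/

theorem lintegral_fin_prod_eq_prod {E : Type*} [MeasurableSpace E] {n : ℕ}
    (μ : Fin n → Measure E) [∀ i, SigmaFinite (μ i)] {f : Fin n → E → ℝ≥0∞}
    (hf : ∀ i, Measurable (f i)) :
    ∫⁻ x, ∏ i, f i (x i) ∂Measure.pi μ = ∏ i, ∫⁻ x, f i x ∂μ i := by
  induction n with
  | zero => simp
  | succ n ih =>
    have hm : Measurable fun x : Fin n → E => ∏ i, f (Fin.succ i) (x i) :=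
      Finset.measurable_fun_prod _ fun i _ => (hf _).comp (measurable_pi_apply i)
    refine ((measurePreserving_piFinSuccAbove μ 0).symm.lintegral_map_equiv _ _).trans ?_
    simp only [MeasurableEquiv.piFinSuccAbove_symm_apply, Fin.insertNthEquiv, Fin.prod_univ_succ,
      Fin.insertNth_zero, Equiv.coe_fn_mk, Fin.cons_succ, Fin.zero_succAbove, Fin.cons_zero]
    rw [← ih _ fun i => hf i.succ]
    exact lintegral_prod_mul (hf 0).aemeasurable hm.aemeasurable

theorem pi_withDensity {E : Type*} [MeasurableSpace E] {n : ℕ}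
    (μ : Measure E) [SigmaFinite μ] {f : E → ℝ≥0∞} (hf : Measurable f)
    [SigmaFinite (μ.withDensity f)] :
    Measure.pi (fun _ : Fin n => μ.withDensity f) =
      (Measure.pi fun _ : Fin n => μ).withDensity fun x => ∏ i, f (x i) := by
  refine Measure.pi_eq fun s hs => ?_
  have h : MeasurableSet (Set.univ.pi s) := MeasurableSet.univ_pi hs
  rw [withDensity_apply _ h, ← lintegral_indicator h]
  simp only [withDensity_apply _ (hs _), ← lintegral_indicator (hs _)]
  rw [← lintegral_fin_prod_eq_prod _ fun i => hf.indicator (hs i)]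
  refine lintegral_congr fun x => ?_
  by_cases hx : x ∈ Set.univ.pi s
  · rw [Set.indicator_of_mem hx]
    exact Finset.prod_congr rfl fun i _ => (Set.indicator_of_mem (hx i trivial) f).symm
  · rw [Set.indicator_of_notMem hx]
    simp only [Set.mem_pi, Set.mem_univ, true_implies, not_forall] at hx
    obtain ⟨i, hi⟩ := hx
    exact (Finset.prod_eq_zero (Finset.mem_univ i) (Set.indicator_of_notMem hi f)).symm

theorem lintegral_exp_neg_sq : ∫⁻ x : ℝ, ENNReal.ofReal (Real.exp (-x ^ 2)) =
    ENNReal.ofReal (Real.pi ^ (1 / 2 : ℝ)) := by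
  have h := integral_gaussian 1
  have hi := integrable_exp_neg_mul_sq one_pos
  rw [← ofReal_integral_eq_lintegral_ofReal (by simpa using hi)
    (.of_forall fun x => (Real.exp_pos _).le), ← Real.sqrt_eq_rpow]
  simp only [neg_mul, one_mul, div_one] at h
  rw [h]

theorem lintegral_exp_neg_dotProduct_self (p : ℕ) :
    ∫⁻ x : Fin p → ℝ, ENNReal.ofReal (Real.exp (-(x ⬝ᵥ x))) =
      ENNReal.ofReal (Real.pi ^ ((p : ℝ) / 2)) := by
  have h : ∀ x : Fin p → ℝ, ENNReal.ofReal (Real.exp (-(x ⬝ᵥ x))) =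
      ∏ i, ENNReal.ofReal (Real.exp (-x i ^ 2)) := by
    intro x
    rw [← ENNReal.ofReal_prod_of_nonneg fun i _ => (Real.exp_pos _).le, ← Real.exp_sum,
      Finset.sum_neg_distrib]
    simp only [dotProduct, sq]
  simp only [h]
  rw [volume_pi, lintegral_fin_prod_eq_prod (fun _ => volume)
    (f := fun _ x => ENNReal.ofReal (Real.exp (-x ^ 2))) (fun _ => by fun_prop)]
  simp only [lintegral_exp_neg_sq, Finset.prod_const, Finset.card_univ, Fintype.card_fin]
  rw [← ENNReal.ofReal_pow (by positivity), ← Real.rpow_natCast, ← Real.rpow_mul Real.pi_pos.le]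
  congr 2
  ring

theorem lintegral_exp_neg_trace_mul_transpose (p : ℕ) :
    ∫⁻ A, ENNReal.ofReal (Real.exp (-(A * Aᵀ).trace)) ∂lebesgueMatrix p =
      ENNReal.ofReal (Real.pi ^ ((p : ℝ) ^ 2 / 2)) := by
  have h : ∀ A : Matrix (Fin p) (Fin p) ℝ, ENNReal.ofReal (Real.exp (-(A * Aᵀ).trace)) =
      ∏ i, ENNReal.ofReal (Real.exp (-(A i ⬝ᵥ A i))) := by
    intro A
    rw [← ENNReal.ofReal_prod_of_nonneg fun i _ => (Real.exp_pos _).le, ← Real.exp_sum,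
      Finset.sum_neg_distrib]
    rfl
  have hm : Measurable fun x : Fin p → ℝ => ENNReal.ofReal (Real.exp (-(x ⬝ᵥ x))) := by
    unfold dotProduct
    fun_prop
  simp only [h]
  refine (lintegral_fin_prod_eq_prod (fun _ : Fin p => (volume : Measure (Fin p → ℝ)))
    (fun _ => hm)).trans ?_
  simp only [lintegral_exp_neg_dotProduct_self, Finset.prod_const, Finset.card_univ,
    Fintype.card_fin]
  rw [← ENNReal.ofReal_pow (by positivity), ← Real.rpow_natCast, ← Real.rpow_mul Real.pi_pos.le]
  congr 2
  ring

theorem lintegral_exp_neg_quadForm_inv {p : ℕ} {S : Matrix (Fin p) (Fin p) ℝ} (hS : S.PosDef) :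
    ∫⁻ x : Fin p → ℝ, ENNReal.ofReal (Real.exp (-(x ⬝ᵥ (S⁻¹ *ᵥ x)))) =
      ENNReal.ofReal (S.det ^ (1 / 2 : ℝ) * Real.pi ^ ((p : ℝ) / 2)) := by
  obtain ⟨B, hB, rfl⟩ := PosDef.exists_eq_mul_transpose hS
  have hm : Measurable fun x : Fin p → ℝ => ENNReal.ofReal (Real.exp (-(x ⬝ᵥ x))) := by
    unfold dotProduct
    fun_prop
  have hB' : B⁻¹.det ≠ 0 := by simpa using hB
  have h := lintegral_map (μ := volume) hm
    ((toLin' B⁻¹).continuous_of_finiteDimensional.measurable)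
  rw [Real.map_matrix_volume_pi_eq_smul_volume_pi hB', lintegral_smul_measure,
    lintegral_exp_neg_dotProduct_self] at h
  have e : ∀ x : Fin p → ℝ, x ⬝ᵥ ((B * Bᵀ)⁻¹ *ᵥ x) = toLin' B⁻¹ x ⬝ᵥ toLin' B⁻¹ x := by
    intro x
    rw [Matrix.mul_inv_rev, ← transpose_nonsing_inv, ← mulVec_mulVec, toLin'_apply,
      dotProduct_mulVec, vecMul_transpose]
  simp only [e, ← h]
  rw [smul_eq_mul, ← ENNReal.ofReal_mul (abs_nonneg _), det_nonsing_inv, Ring.inverse_eq_inv',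
    inv_inv, det_mul, det_transpose, ← Real.sqrt_eq_rpow, Real.sqrt_mul_self_eq_abs]

/-- For each `A`, `t ↦ det (A + t I)` is the characteristic polynomial of `-A` and has finitely many
zeros. By Fubini some single `t` works for almost every `A`, and translation by `t I` preserves
Lebesgue measure. -/
theorem ae_lebesgueMatrix_det_ne_zero (p : ℕ) : ∀ᵐ A ∂lebesgueMatrix p, A.det ≠ 0 := by
  let f : Matrix (Fin p) (Fin p) ℝ × ℝ → ℝ := fun q => (q.1 + q.2 • (1 : Matrix _ _ ℝ)).det
  have hf : Measurable f :=
    ((continuous_fst.add (continuous_snd.smul continuous_const)).matrix_det).measurable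
  have hs : MeasurableSet {q | f q = 0} := hf (measurableSet_singleton 0)
  have hA : ∀ A : Matrix (Fin p) (Fin p) ℝ, ∀ᵐ t : ℝ, f (A, t) ≠ 0 := by
    intro A
    have hfin : {t : ℝ | f (A, t) = 0} ⊆ ((-A).charpoly.roots.toFinset : Set ℝ) := by
      intro t ht
      have h1 := eval_charpoly (-A) t
      simp only [Finset.mem_coe, Multiset.mem_toFinset]
      rw [Polynomial.mem_roots (charpoly_monic _).ne_zero, Polynomial.IsRoot, h1, ← ht]
      simp only [f]
      congr 1
      rw [sub_neg_eq_add, add_comm, smul_one_eq_diagonal]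
      rfl
    refine measure_mono_null (fun t ht => hfin ?_) (Finset.measure_zero _ volume)
    simpa using ht
  have h1 : ∀ᵐ A ∂lebesgueMatrix p, ∀ᵐ t : ℝ, f (A, t) ≠ 0 := .of_forall hA
  obtain ⟨t, ht⟩ := ((Measure.ae_ae_comm (μ := lebesgueMatrix p) (ν := (volume : Measure ℝ))
    (p := fun A t => f (A, t) ≠ 0) hs.compl).1 h1).exists
  have : (volume : Measure (Fin p → Fin p → ℝ)).IsAddHaarMeasure :=
    Measure.pi.isAddHaarMeasure fun _ : Fin p => (volume : Measure (Fin p → ℝ))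
  have : (lebesgueMatrix p).IsAddRightInvariant :=
    inferInstanceAs (volume : Measure (Fin p → Fin p → ℝ)).IsAddRightInvariant
  filter_upwards [(measurePreserving_add_right (lebesgueMatrix p)
    (-(t • (1 : Matrix (Fin p) (Fin p) ℝ)))).quasiMeasurePreserving.ae ht] with A hA
  simpa [f] using hA

/-! ### The multivariate gamma integral, by bordering. -/

/-- The entries on and above the diagonal of a `(p + 1) × (p + 1)` matrix: those of the lower right
`p × p` block, the rest of the first row, and the corner. -/
noncomputable def upperSuccEquiv (p : ℕ) :
    {q : Fin p × Fin p // q.1 ≤ q.2} ⊕ (Fin p ⊕ Unit) ≃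
      {q : Fin (p + 1) × Fin (p + 1) // q.1 ≤ q.2} :=
  Equiv.ofBijective
    (Sum.elim (fun q => ⟨(q.1.1.succ, q.1.2.succ), Fin.succ_le_succ_iff.2 q.2⟩)
      (Sum.elim (fun j => ⟨(0, j.succ), Fin.zero_le _⟩) fun _ => ⟨(0, 0), le_rfl⟩)) <| by
    constructor
    · rintro (⟨⟨a, b⟩, h⟩ | a | a) (⟨⟨c, d⟩, h'⟩ | c | c) <;>
        simp [Fin.ext_iff]
    · rintro ⟨⟨a, b⟩, h⟩
      induction a using Fin.cases with
      | zero =>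
        induction b using Fin.cases with
        | zero => exact ⟨Sum.inr (Sum.inr ()), rfl⟩
        | succ b => exact ⟨Sum.inr (Sum.inl b), rfl⟩
      | succ a =>
        induction b using Fin.cases with
        | zero => simp at h
        | succ b => exact ⟨Sum.inl ⟨(a, b), Fin.succ_le_succ_iff.1 h⟩, rfl⟩

/-- The symmetric matrix with lower right block `S`, corner `s` and remaining border `v`. -/
def bordered {p : ℕ} (S : Matrix (Fin p) (Fin p) ℝ) (v : Fin p → ℝ) (s : ℝ) :
    Matrix (Fin (p + 1)) (Fin (p + 1)) ℝ :=
  (fromBlocks S (replicateCol Unit v) (replicateCol Unit v)ᵀ (Matrix.of fun _ _ => s)).submatrix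
    ((finSuccEquiv p).trans (Equiv.optionEquivSumPUnit (Fin p)))
    ((finSuccEquiv p).trans (Equiv.optionEquivSumPUnit (Fin p)))

theorem lintegral_lebesgueSym_succ {p : ℕ} {F : Matrix (Fin (p + 1)) (Fin (p + 1)) ℝ → ℝ≥0∞}
    (hF : Measurable F) :
    ∫⁻ S, F S ∂lebesgueSym (p + 1) =
      ∫⁻ S, (∫⁻ v : Fin p → ℝ, ∫⁻ s : ℝ, F (bordered S v s)) ∂lebesgueSym p := by
  have hb : Measurable fun q : Matrix (Fin p) (Fin p) ℝ × (Fin p → ℝ) × ℝ =>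
      F (bordered q.1 q.2.1 q.2.2) := by
    refine hF.comp (Continuous.measurable ?_)
    refine Continuous.matrix_submatrix (Continuous.matrix_fromBlocks continuous_fst ?_ ?_ ?_) _ _
    · exact continuous_matrix fun i j => by simp only [replicateCol_apply]; fun_prop
    · exact continuous_matrix fun i j => by simp only [transpose_apply, replicateCol_apply]; fun_prop
    · exact continuous_matrix fun i j => by simp only [of_apply]; fun_prop
  have hb' : ∀ S : Matrix (Fin p) (Fin p) ℝ, Measurable fun q : (Fin p → ℝ) × ℝ =>
      F (bordered S q.1 q.2) := fun S => hb.comp (measurable_const.prodMk measurable_id)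
  -- The splitting into block, border and corner is a chain of relabelings of coordinates, each
  -- preserving volume.
  have m1 := volume_measurePreserving_piCongrLeft (fun _ => ℝ) (upperSuccEquiv p)
  have m2 := (volume_measurePreserving_sumPiEquivProdPi_symm
    (fun _ : {q : Fin p × Fin p // q.1 ≤ q.2} ⊕ (Fin p ⊕ Unit) => ℝ))
  have m3 := (volume_measurePreserving_sumPiEquivProdPi_symm (fun _ : Fin p ⊕ Unit => ℝ))
  have m4 := (volume_preserving_funUnique Unit ℝ).symm
  have m5 := (MeasurePreserving.id (volume : Measure ({q : Fin p × Fin p // q.1 ≤ q.2} → ℝ))).prod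
    (m3.comp ((MeasurePreserving.id (volume : Measure (Fin p → ℝ))).prod m4))
  have m6 := m1.comp (m2.comp m5)
  have key : ∀ x : {q : Fin p × Fin p // q.1 ≤ q.2} → ℝ, ∀ v : Fin p → ℝ, ∀ s : ℝ,
      symOfUpper ((MeasurableEquiv.piCongrLeft (fun _ => ℝ) (upperSuccEquiv p))
        ((MeasurableEquiv.sumPiEquivProdPi _).symm (x, (MeasurableEquiv.sumPiEquivProdPi _).symm
          (v, (MeasurableEquiv.funUnique Unit ℝ).symm s)))) = bordered (symOfUpper x) v s := by
    intro x v s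
    have ap := Equiv.piCongrLeft_apply_apply (fun _ => ℝ) (upperSuccEquiv p)
      ((MeasurableEquiv.sumPiEquivProdPi _).symm (x, (MeasurableEquiv.sumPiEquivProdPi _).symm
          (v, (MeasurableEquiv.funUnique Unit ℝ).symm s)))
    change symOfUpper (Equiv.piCongrLeft (fun _ => ℝ) (upperSuccEquiv p) _) = _
    generalize Equiv.piCongrLeft (fun _ => ℝ) (upperSuccEquiv p) _ = Y at ap ⊢
    have hY : ∀ i j a, (min i j, max i j) = (upperSuccEquiv p a).1 →
        symOfUpper Y i j = Y (upperSuccEquiv p a) :=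
      fun i j a h => congrArg Y (Subtype.ext h)
    ext i j
    induction i using Fin.cases with
    | zero =>
      induction j using Fin.cases with
      | zero => exact (hY _ _ (Sum.inr (Sum.inr ())) (by simp; rfl)).trans (ap _)
      | succ j => exact (hY _ _ (Sum.inr (Sum.inl j)) (by simp; rfl)).trans (ap _)
    | succ i =>
      induction j using Fin.cases with
      | zero => exact (hY _ _ (Sum.inr (Sum.inl i)) (by simp; rfl)).trans (ap _)
      | succ j =>
        refine (hY _ _ (Sum.inl ⟨(min i j, max i j), min_le_max⟩) ?_).trans (ap _)
        rcases le_total i j with h | h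
        · simp only [min_eq_left h, max_eq_right h, Fin.succ_le_succ_iff.2 h, inf_of_le_left,
            sup_of_le_right]
          rfl
        · simp only [min_eq_right h, max_eq_left h, Fin.succ_le_succ_iff.2 h, inf_of_le_right,
            sup_of_le_left]
          rfl
  rw [lebesgueSym, lintegral_map hF (measurable_symOfUpper _)]
  refine (m6.lintegral_comp (hF.comp (measurable_symOfUpper _))).symm.trans ?_
  refine (lintegral_congr (g := fun q : ({q : Fin p × Fin p // q.1 ≤ q.2} → ℝ) ×
    (Fin p → ℝ) × ℝ => F (bordered (symOfUpper q.1) q.2.1 q.2.2))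
    fun q => congrArg F (key q.1 q.2.1 q.2.2)).trans ?_
  refine (lintegral_prod _ ?_).trans ?_
  · exact (hb.comp (((measurable_symOfUpper p).comp measurable_fst).prodMk
      measurable_snd)).aemeasurable
  · rw [lebesgueSym, lintegral_map _ (measurable_symOfUpper p)]
    · refine lintegral_congr fun x => ?_
      exact lintegral_prod _ (hb' _).aemeasurable
    · refine Measurable.lintegral_prod_right'
        (f := fun q : Matrix (Fin p) (Fin p) ℝ × (Fin p → ℝ) =>
          ∫⁻ s : ℝ, F (bordered q.1 q.2 s)) ?_
      refine Measurable.lintegral_prod_right'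
        (f := fun q : (Matrix (Fin p) (Fin p) ℝ × (Fin p → ℝ)) × ℝ =>
          F (bordered q.1.1 q.1.2 q.2)) ?_
      exact hb.comp MeasurableEquiv.prodAssoc.measurable

theorem replicateCol_schur_apply {p : ℕ} (S : Matrix (Fin p) (Fin p) ℝ) (v : Fin p → ℝ)
    (s : ℝ) (i j : Unit) :
    ((Matrix.of fun _ _ => s : Matrix Unit Unit ℝ) - (replicateCol Unit v)ᵀ * S⁻¹ * replicateCol Unit v) i j =
      s - v ⬝ᵥ (S⁻¹ *ᵥ v) := by
  rw [Matrix.mul_assoc]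
  rfl

theorem det_bordered {p : ℕ} {S : Matrix (Fin p) (Fin p) ℝ} (hS : S.det ≠ 0) (v : Fin p → ℝ)
    (s : ℝ) : (bordered S v s).det = S.det * (s - v ⬝ᵥ (S⁻¹ *ᵥ v)) := by
  rw [bordered, det_submatrix_equiv_self]
  have : Invertible S := invertibleOfIsUnitDet S (Ne.isUnit hS)
  rw [det_fromBlocks₁₁, det_unique (n := Unit), invOf_eq_nonsing_inv, replicateCol_schur_apply]

theorem trace_bordered {p : ℕ} (S : Matrix (Fin p) (Fin p) ℝ) (v : Fin p → ℝ)
    (s : ℝ) : (bordered S v s).trace = S.trace + s := by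
  simp [trace, Fin.sum_univ_succ, bordered, add_comm]

/-- The sign of the Schur complement decides semidefiniteness, and the determinant formula upgrades
it to definiteness. -/
theorem posDef_bordered_iff {p : ℕ} {S : Matrix (Fin p) (Fin p) ℝ} (hS : S.PosDef)
    (v : Fin p → ℝ) (s : ℝ) : (bordered S v s).PosDef ↔ 0 < s - v ⬝ᵥ (S⁻¹ *ᵥ v) := by
  have hdet := det_bordered hS.det_pos.ne' v s
  refine ⟨fun h => ?_, fun h => ?_⟩
  · have := h.det_pos
    rw [hdet] at this
    exact pos_of_mul_pos_right this hS.det_pos.le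
  · have hs : (bordered S v s).PosSemidef := by
      have : Invertible S := invertibleOfIsUnitDet S (Ne.isUnit hS.det_pos.ne')
      rw [bordered, posSemidef_submatrix_equiv, ← conjTranspose_eq_transpose_of_trivial,
        PosDef.fromBlocks₁₁ _ _ hS, conjTranspose_eq_transpose_of_trivial]
      have e : ((Matrix.of fun _ _ => s : Matrix Unit Unit ℝ) - (replicateCol Unit v)ᵀ * S⁻¹ * replicateCol Unit v) =
          diagonal fun _ => s - v ⬝ᵥ (S⁻¹ *ᵥ v) := by
        ext i j
        rw [replicateCol_schur_apply]
        simp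
      rw [e, posSemidef_diagonal_iff]
      exact fun _ => h.le
    rw [hs.posDef_iff_det_ne_zero, hdet]
    exact (mul_pos hS.det_pos h).ne'

theorem PosDef.of_bordered {p : ℕ} {S : Matrix (Fin p) (Fin p) ℝ}
    {v : Fin p → ℝ} {s : ℝ} (h : (bordered S v s).PosDef) : S.PosDef := by
  have := h.submatrix (Fin.succ_injective p)
  convert this using 1
  ext i j
  simp [bordered]

open Classical in
/-- The integrand `(det S) ^ b * exp (-tr S)` of the multivariate gamma function. -/
noncomputable def gammaIntegrand {p : ℕ} (b : ℝ) (S : Matrix (Fin p) (Fin p) ℝ) : ℝ≥0∞ :=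
  if S.PosDef then ENNReal.ofReal (S.det ^ b * Real.exp (-S.trace)) else 0

theorem measurable_gammaIntegrand (p : ℕ) (b : ℝ) : Measurable (gammaIntegrand (p := p) b) :=
  Measurable.ite (measurableSet_posDef p) (((measurable_det p).pow_const _).mul
    (measurable_trace p).neg.exp).ennreal_ofReal measurable_const

/-- Shifting the corner by `vᵀ S⁻¹ v` turns the Schur complement into `s`, so the determinant
becomes `det S * s` and the integrand separates in `S`, `v` and `s`. -/
theorem gammaIntegrand_bordered {p : ℕ} {S : Matrix (Fin p) (Fin p) ℝ} (hS : S.PosDef) (b : ℝ)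
    (v : Fin p → ℝ) (s : ℝ) :
    gammaIntegrand b (bordered S v (s + v ⬝ᵥ (S⁻¹ *ᵥ v))) =
      gammaIntegrand b S * ENNReal.ofReal (Real.exp (-(v ⬝ᵥ (S⁻¹ *ᵥ v)))) *
        (Set.Ioi (0 : ℝ)).indicator (fun t => ENNReal.ofReal (Real.exp (-t) * t ^ b)) s := by
  have h := posDef_bordered_iff hS v (s + v ⬝ᵥ (S⁻¹ *ᵥ v))
  rw [add_sub_cancel_right] at h
  rw [gammaIntegrand, gammaIntegrand, if_pos hS]
  by_cases hs : 0 < s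
  · have hd := hS.det_pos
    rw [if_pos (h.2 hs), Set.indicator_of_mem (Set.mem_Ioi.2 hs), ← ENNReal.ofReal_mul (by positivity),
      ← ENNReal.ofReal_mul (by positivity), det_bordered hS.det_pos.ne', trace_bordered,
      add_sub_cancel_right, Real.mul_rpow hd.le hs.le, neg_add, neg_add, Real.exp_add,
      Real.exp_add]
    congr 1
    ring
  · rw [if_neg (mt h.1 hs), Set.indicator_of_notMem (mt Set.mem_Ioi.1 hs), mul_zero]

theorem lintegral_gamma {b : ℝ} (hb : -1 < b) :
    ∫⁻ s : ℝ, (Set.Ioi (0 : ℝ)).indicator (fun t => ENNReal.ofReal (Real.exp (-t) * t ^ b)) s =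
      ENNReal.ofReal (Real.Gamma (b + 1)) := by
  have hi := Real.GammaIntegral_convergent (s := b + 1) (by linarith)
  rw [lintegral_indicator measurableSet_Ioi, Real.Gamma_eq_integral (by linarith)]
  rw [add_sub_cancel_right] at hi ⊢
  rw [ofReal_integral_eq_lintegral_ofReal hi]
  filter_upwards [ae_restrict_mem measurableSet_Ioi] with t ht
  exact mul_nonneg (Real.exp_pos _).le (Real.rpow_nonneg (le_of_lt ht) _)

/-- The corner contributes a gamma integral; the Gaussian integral over the border contributes `(det
S) ^ (1 / 2)`, which raises the exponent. If `S` is not positive definite, no bordering of it is,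
and both sides vanish. -/
theorem lintegral_gammaIntegrand_bordered {p : ℕ} (S : Matrix (Fin p) (Fin p) ℝ) {b : ℝ}
    (hb : -1 < b) :
    ∫⁻ v : Fin p → ℝ, ∫⁻ s : ℝ, gammaIntegrand b (bordered S v s) =
      ENNReal.ofReal (Real.pi ^ ((p : ℝ) / 2) * Real.Gamma (b + 1)) *
        gammaIntegrand (b + 1 / 2) S := by
  by_cases hS : S.PosDef
  · have hd := hS.det_pos
    have h1 : ∀ v : Fin p → ℝ, ∫⁻ s : ℝ, gammaIntegrand b (bordered S v s) =
        gammaIntegrand b S * ENNReal.ofReal (Real.Gamma (b + 1)) *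
          ENNReal.ofReal (Real.exp (-(v ⬝ᵥ (S⁻¹ *ᵥ v)))) := by
      intro v
      rw [← lintegral_add_right_eq_self _ (v ⬝ᵥ (S⁻¹ *ᵥ v))]
      simp only [gammaIntegrand_bordered hS]
      rw [lintegral_const_mul, lintegral_gamma hb]
      · ring
      · exact Measurable.indicator (by fun_prop) measurableSet_Ioi
    simp only [h1]
    have hm : Measurable fun v : Fin p → ℝ =>
        ENNReal.ofReal (Real.exp (-(v ⬝ᵥ (S⁻¹ *ᵥ v)))) :=
      (continuous_id.dotProduct (continuous_const.matrix_mulVec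
        continuous_id)).measurable.neg.exp.ennreal_ofReal
    have hg : 0 < Real.Gamma (b + 1) := Real.Gamma_pos_of_pos (by linarith)
    rw [lintegral_const_mul _ hm, lintegral_exp_neg_quadForm_inv hS, gammaIntegrand,
      gammaIntegrand, if_pos hS, if_pos hS, ← ENNReal.ofReal_mul (by positivity),
      ← ENNReal.ofReal_mul (by positivity), ← ENNReal.ofReal_mul (by positivity),
      Real.rpow_add hd]
    congr 1
    ring
  · have h1 : ∀ v : Fin p → ℝ, ∀ s, gammaIntegrand b (bordered S v s) = 0 :=
      fun v s => if_neg fun h => hS (PosDef.of_bordered h)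
    have h2 : gammaIntegrand (b + 1 / 2) S = 0 := if_neg hS
    rw [h2, mul_zero]
    simp only [h1, lintegral_zero]

theorem multiGamma_succ (p : ℕ) (a : ℝ) :
    multiGamma (p + 1) a =
      Real.pi ^ ((p : ℝ) / 2) * Real.Gamma (a - (p : ℝ) / 2) * multiGamma p a := by
  rw [multiGamma, multiGamma, Fin.prod_univ_castSucc]
  simp only [Fin.val_castSucc, Fin.val_last]
  rw [show ((p + 1 : ℕ) : ℝ) * (((p + 1 : ℕ) : ℝ) - 1) / 4 = p / 2 + p * (p - 1) / 4 by
    push_cast; ring, Real.rpow_add Real.pi_pos]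
  ring

theorem multiGamma_pos {p : ℕ} {a : ℝ} (ha : ((p : ℝ) - 1) / 2 < a) : 0 < multiGamma p a := by
  refine mul_pos (by positivity) (Finset.prod_pos fun j _ => Real.Gamma_pos_of_pos ?_)
  have : ((j : ℕ) : ℝ) + 1 ≤ p := by exact_mod_cast j.2
  linarith

theorem lintegral_gammaIntegrand (p : ℕ) {a : ℝ} (ha : ((p : ℝ) - 1) / 2 < a) :
    ∫⁻ S, gammaIntegrand (a - ((p : ℝ) + 1) / 2) S ∂lebesgueSym p =
      ENNReal.ofReal (multiGamma p a) := by
  induction p with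
  | zero =>
    rw [lebesgueSym, lintegral_map (measurable_gammaIntegrand _ _) (measurable_symOfUpper _)]
    -- For `p = 0` the only matrix is the empty one, of determinant 1, carrying unit mass.
    have h : ∀ x, gammaIntegrand (a - (((0 : ℕ) : ℝ) + 1) / 2) (symOfUpper (p := 0) x) = 1 := by
      intro x
      have hp : (symOfUpper (p := 0) x).PosDef := by
        rw [Subsingleton.elim (symOfUpper x) 1]
        exact PosDef.one
      rw [gammaIntegrand, if_pos hp]
      simp [trace]
    simp only [h]
    rw [lintegral_one, volume_pi, Measure.pi_empty_univ]
    simp [multiGamma]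
  | succ p ih =>
    push_cast at ha
    have h := ih (by linarith)
    rw [lintegral_lebesgueSym_succ (measurable_gammaIntegrand _ _)]
    simp only [lintegral_gammaIntegrand_bordered _
      (show -1 < a - (((p + 1 : ℕ) : ℝ) + 1) / 2 by push_cast; linarith)]
    rw [lintegral_const_mul _ (measurable_gammaIntegrand _ _),
      show a - (((p + 1 : ℕ) : ℝ) + 1) / 2 + 1 / 2 = a - ((p : ℝ) + 1) / 2 by push_cast; ring, h,
      multiGamma_succ, show a - (((p + 1 : ℕ) : ℝ) + 1) / 2 + 1 = a - (p : ℝ) / 2 by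
        push_cast; ring, ← ENNReal.ofReal_mul]
    have := Real.Gamma_pos_of_pos (s := a - (p : ℝ) / 2) (by linarith)
    positivity

theorem lintegral_invMeasure {p : ℕ} {F : Matrix (Fin p) (Fin p) ℝ → ℝ≥0∞}
    (hF : Measurable F) :
    ∫⁻ S, F S ∂invMeasure p = ∫⁻ S, invDensity S * F S ∂lebesgueSym p :=
  lintegral_withDensity_eq_lintegral_mul _ (measurable_invDensity p) hF

theorem lintegral_invMeasure_gammaIntegrand (p : ℕ) {a : ℝ} (ha : ((p : ℝ) - 1) / 2 < a) :
    ∫⁻ S, gammaIntegrand a S ∂invMeasure p = ENNReal.ofReal (multiGamma p a) := by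
  rw [lintegral_invMeasure (measurable_gammaIntegrand _ _), ← lintegral_gammaIntegrand p ha]
  refine lintegral_congr fun S => ?_
  by_cases hS : S.PosDef
  · have hd := hS.det_pos
    rw [invDensity, gammaIntegrand, gammaIntegrand, if_pos hS, if_pos hS, if_pos hS,
      ← ENNReal.ofReal_mul (by positivity), ← mul_assoc, ← Real.rpow_add hd,
      show -((p : ℝ) + 1) / 2 + a = a - ((p : ℝ) + 1) / 2 by ring]
  · rw [gammaIntegrand, gammaIntegrand, if_neg hS, if_neg hS, mul_zero]

/-! ### The image of Haar measure under `A ↦ A Aᵀ`. -/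

theorem posDef_mul_transpose_self {p : ℕ} {A : Matrix (Fin p) (Fin p) ℝ} (hA : A.det ≠ 0) :
    (A * Aᵀ).PosDef := by
  have := (posDef_congr_iff (S := 1) hA).2 PosDef.one
  rwa [Matrix.mul_one] at this

theorem det_mul_transpose_rpow {p : ℕ} (A : Matrix (Fin p) (Fin p) ℝ) (b : ℝ) :
    (A * Aᵀ).det ^ b = |A.det| ^ (2 * b) := by
  rw [det_mul, det_transpose, ← abs_mul_abs_self, ← sq, ← Real.rpow_natCast,
    ← Real.rpow_mul (abs_nonneg _)]
  norm_num

/-- The exponent `p / 2` cancels the Haar weight and leaves a pure Gaussian. -/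
theorem lintegral_haarWeight_gammaIntegrand (p : ℕ) :
    ∫⁻ A, haarWeight A * gammaIntegrand ((p : ℝ) / 2) (A * Aᵀ) ∂lebesgueMatrix p =
      ENNReal.ofReal (Real.pi ^ ((p : ℝ) ^ 2 / 2)) := by
  rw [← lintegral_exp_neg_trace_mul_transpose]
  refine lintegral_congr_ae ?_
  filter_upwards [ae_lebesgueMatrix_det_ne_zero p] with A hA
  have h : 0 < |A.det| := abs_pos.2 hA
  rw [gammaIntegrand, if_pos (posDef_mul_transpose_self hA), haarWeight,
    ← ENNReal.ofReal_mul (by positivity), det_mul_transpose_rpow, mul_div_cancel₀ _ two_ne_zero,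
    Real.rpow_natCast, inv_mul_cancel_left₀ (by positivity)]

theorem half_dim_lt {p : ℕ} : ((p : ℝ) - 1) / 2 < (p : ℝ) / 2 := by linarith

/-- The image of the Haar measure on `GL_p` under `A ↦ A Aᵀ` is a multiple of the invariant measure
on the cone of positive definite matrices. -/
theorem lintegral_haarWeight_comp_mul_transpose (p : ℕ)
    {h : Matrix (Fin p) (Fin p) ℝ → ℝ≥0∞} (hh : Measurable h) :
    ∫⁻ A, haarWeight A * h (A * Aᵀ) ∂lebesgueMatrix p =
      ENNReal.ofReal (Real.pi ^ ((p : ℝ) ^ 2 / 2) / multiGamma p ((p : ℝ) / 2)) *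
        ∫⁻ S, h S ∂invMeasure p := by
  have hg := measurable_gammaIntegrand p ((p : ℝ) / 2)
  have hpos := multiGamma_pos (half_dim_lt (p := p))
  have key := fun {h : Matrix (Fin p) (Fin p) ℝ → ℝ≥0∞} (hh : Measurable h) =>
    lintegral_haarWeight_mul_lintegral (invMeasure p) (ae_invMeasure_posDef p)
      (fun G hG F hF => lintegral_invMeasure_congr hG hF) hh hg
  -- Taking `h = g` identifies the unknown integral of `g (A⁻¹ A⁻ᵀ)` with that of `g (A Aᵀ)`, which
  -- is known.
  have h1 := key hg
  have h2 := key hh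
  rw [lintegral_invMeasure_gammaIntegrand p half_dim_lt] at h1 h2
  have hne : ENNReal.ofReal (multiGamma p ((p : ℝ) / 2)) ≠ 0 := by
    rwa [ne_eq, ENNReal.ofReal_eq_zero, not_le]
  rw [ENNReal.mul_left_inj hne ENNReal.ofReal_ne_top, lintegral_haarWeight_gammaIntegrand] at h1
  rw [← h1] at h2
  rw [← ENNReal.mul_left_inj hne ENNReal.ofReal_ne_top, h2, mul_right_comm,
    ← ENNReal.ofReal_mul (by positivity), div_mul_cancel₀ _ hpos.ne']

/-! ### Inversion and the inverse Wishart integral. -/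

theorem inv_congr_transpose {p : ℕ} (G S : Matrix (Fin p) (Fin p) ℝ) (hG : G.det ≠ 0) :
    (G⁻¹ᵀ * S * G⁻¹ᵀᵀ)⁻¹ = G * S⁻¹ * Gᵀ := by
  rw [Matrix.mul_inv_rev, Matrix.mul_inv_rev, transpose_transpose, ← transpose_nonsing_inv,
    nonsing_inv_nonsing_inv _ hG.isUnit, Matrix.mul_assoc]

/-- The invariant measure on positive definite matrices is preserved by inversion. -/
theorem lintegral_invMeasure_inv (p : ℕ) {F : Matrix (Fin p) (Fin p) ℝ → ℝ≥0∞}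
    (hF : Measurable F) : ∫⁻ S, F S⁻¹ ∂invMeasure p = ∫⁻ S, F S ∂invMeasure p := by
  have hinv := measurable_matrix_inv p
  -- The image under inversion is again invariant, with `G` acting through `G⁻ᵀ`, so by uniqueness
  -- it is a multiple of `invMeasure p`.
  let μ := (invMeasure p).map fun S => S⁻¹
  have hμ : ∀ {F : Matrix (Fin p) (Fin p) ℝ → ℝ≥0∞}, Measurable F →
      ∫⁻ S, F S ∂μ = ∫⁻ S, F S⁻¹ ∂invMeasure p := fun hF => lintegral_map hF hinv
  have hμ1 : ∀ᵐ S ∂μ, S.PosDef := by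
    refine (ae_map_iff hinv.aemeasurable (measurableSet_posDef p)).2 ?_
    filter_upwards [ae_invMeasure_posDef p] with S hS using hS.inv
  have hμ2 : ∀ G : Matrix (Fin p) (Fin p) ℝ, G.det ≠ 0 →
      ∀ F : Matrix (Fin p) (Fin p) ℝ → ℝ≥0∞, Measurable F →
        ∫⁻ S, F (G * S * Gᵀ) ∂μ = ∫⁻ S, F S ∂μ := by
    intro G hG F hF
    refine (hμ (hF.comp (measurable_congr G))).trans ?_
    rw [hμ hF]
    refine Eq.trans ?_ (lintegral_invMeasure_congr (G := G⁻¹ᵀ) (by simpa using hG)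
      (hF.comp hinv))
    simp only [Function.comp_apply, inv_congr_transpose _ _ hG]
  let g₀ : Matrix (Fin p) (Fin p) ℝ → ℝ≥0∞ := gammaIntegrand ((p : ℝ) / 2)
  have hg₀ : Measurable g₀ := measurable_gammaIntegrand _ _
  -- A test function symmetric under inversion, positive on the cone and of finite integral: it
  -- forces the multiple to be 1.
  let g : Matrix (Fin p) (Fin p) ℝ → ℝ≥0∞ := fun S => min (g₀ S) (g₀ S⁻¹)
  have hg : Measurable g := hg₀.min (hg₀.comp hinv)
  have hpos := multiGamma_pos (half_dim_lt (p := p))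
  have hν₀ := lintegral_invMeasure_gammaIntegrand p (half_dim_lt (p := p))
  have hgμ : ∫⁻ S, g S ∂μ = ∫⁻ S, g S ∂invMeasure p := by
    rw [hμ hg]
    refine lintegral_congr_ae ?_
    filter_upwards [ae_invMeasure_posDef p] with S hS
    simp only [g]
    rw [nonsing_inv_nonsing_inv _ (Ne.isUnit hS.det_pos.ne'), min_comm]
  have hg_top : ∫⁻ S, g S ∂invMeasure p ≠ ∞ := by
    refine ne_top_of_le_ne_top ?_ (lintegral_mono fun S => min_le_left (g₀ S) _)
    rw [hν₀]
    exact ENNReal.ofReal_ne_top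
  have hg_ne : ∫⁻ S, g S ∂invMeasure p ≠ 0 := by
    intro h
    rw [lintegral_eq_zero_iff hg] at h
    have hpos' : ∀ S : Matrix (Fin p) (Fin p) ℝ, S.PosDef → g₀ S ≠ 0 := by
      intro S hS
      have hd := hS.det_pos
      simp only [g₀]
      rw [gammaIntegrand, if_pos hS, ne_eq, ENNReal.ofReal_eq_zero, not_le]
      positivity
    have h0 : ∀ᵐ S ∂invMeasure p, g₀ S = 0 := by
      filter_upwards [h, ae_invMeasure_posDef p] with S h1 h2
      rcases min_choice (g₀ S) (g₀ S⁻¹) with h3 | h3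
      · exact absurd (h3.symm.trans h1) (hpos' _ h2)
      · exact absurd (h3.symm.trans h1) (hpos' _ h2.inv)
    rw [(lintegral_eq_zero_iff hg₀).2 h0] at hν₀
    exact hpos.not_ge (ENNReal.ofReal_eq_zero.1 hν₀.symm)
  have key := lintegral_haarWeight_mul_lintegral (invMeasure p) (ae_invMeasure_posDef p)
    (fun G hG F hF => lintegral_invMeasure_congr hG hF) hF hg
  have key' := lintegral_haarWeight_mul_lintegral μ hμ1 hμ2 hF hg
  -- Needed only to see that the common factor to be cancelled is neither 0 nor infinite.
  have key₀ := lintegral_haarWeight_mul_lintegral (invMeasure p) (ae_invMeasure_posDef p)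
    (fun G hG F hF => lintegral_invMeasure_congr hG hF) hg₀ hg
  rw [hgμ, key, hμ hF] at key'
  rw [lintegral_haarWeight_gammaIntegrand, hν₀] at key₀
  have hne : (∫⁻ A, haarWeight A * g (A⁻¹ * A⁻¹ᵀ) ∂lebesgueMatrix p) ≠ 0 := by
    intro h
    rw [h, zero_mul, mul_eq_zero, ENNReal.ofReal_eq_zero] at key₀
    rcases key₀ with h | h
    · exact (Real.rpow_pos_of_pos Real.pi_pos _).not_ge h
    · exact hg_ne h
  have htop : (∫⁻ A, haarWeight A * g (A⁻¹ * A⁻¹ᵀ) ∂lebesgueMatrix p) ≠ ∞ := by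
    intro h
    rw [h, ENNReal.top_mul] at key₀
    · exact ENNReal.mul_ne_top ENNReal.ofReal_ne_top hg_top key₀
    · rwa [ne_eq, ENNReal.ofReal_eq_zero, not_le]
  exact ((ENNReal.mul_right_inj hne htop).1 key').symm

open Classical in
/-- The kernel `(det S) ^ (-m / 2) * exp (-tr (T S⁻¹) / 2)` of the inverse Wishart density, taken
with respect to the invariant measure. -/
noncomputable def invWishartKernel {p : ℕ} (m : ℝ) (T S : Matrix (Fin p) (Fin p) ℝ) : ℝ≥0∞ :=
  if S.PosDef then ENNReal.ofReal (S.det ^ (-m / 2) * Real.exp (-(1 / 2) * (T * S⁻¹).trace)) else 0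

theorem measurable_trace_mul_inv {p : ℕ} (T : Matrix (Fin p) (Fin p) ℝ) :
    Measurable fun S : Matrix (Fin p) (Fin p) ℝ => (T * S⁻¹).trace :=
  (measurable_trace p).comp ((measurable_matrix_mul_left T).comp (measurable_matrix_inv p))

theorem measurable_invWishartKernel {p : ℕ} (m : ℝ) (T : Matrix (Fin p) (Fin p) ℝ) :
    Measurable (invWishartKernel m T) :=
  Measurable.ite (measurableSet_posDef p) (((measurable_det p).pow_const _).mul
    ((measurable_trace_mul_inv T).const_mul _).exp).ennreal_ofReal measurable_const

/-- With `T = B Bᵀ`, the substitution of `B S⁻¹ Bᵀ / 2` for `S` turns `tr (T S⁻¹) / 2` into `tr S`.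
The factor `(√2)⁻¹` in the congruence absorbs the `1 / 2` of the exponent. -/
theorem lintegral_invWishartKernel {p : ℕ} {m : ℝ} (hm : (p : ℝ) - 1 < m)
    {T : Matrix (Fin p) (Fin p) ℝ} (hT : T.PosDef) :
    ∫⁻ S, invWishartKernel m T S ∂invMeasure p =
      ENNReal.ofReal (2 ^ (m * p / 2) * multiGamma p (m / 2) / T.det ^ (m / 2)) := by
  obtain ⟨B, hB, rfl⟩ := PosDef.exists_eq_mul_transpose hT
  have hBabs : 0 < |B.det| := abs_pos.2 hB
  have hG : (((√2)⁻¹ : ℝ) • B).det ≠ 0 := by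
    rw [det_smul]
    exact mul_ne_zero (by positivity) hB
  have hk := measurable_invWishartKernel m (B * Bᵀ)
  rw [← lintegral_invMeasure_congr hG hk]
  refine (lintegral_invMeasure_inv p (hk.comp (measurable_congr _))).symm.trans ?_
  have e : ∀ᵐ S ∂invMeasure p, invWishartKernel m (B * Bᵀ)
      ((((√2)⁻¹ : ℝ) • B) * S⁻¹ * (((√2)⁻¹ : ℝ) • B)ᵀ) =
      ENNReal.ofReal (2 ^ (m * p / 2) * |B.det| ^ (-m)) * gammaIntegrand (m / 2) S := by
    filter_upwards [ae_invMeasure_posDef p] with S hS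
    have hd := hS.det_pos
    rw [invWishartKernel, gammaIntegrand, if_pos hS, if_pos ((posDef_congr_iff hG).2 hS.inv),
      ← ENNReal.ofReal_mul (by positivity)]
    congr 1
    have e1 : ((((√2)⁻¹ : ℝ) • B) * S⁻¹ * (((√2)⁻¹ : ℝ) • B)ᵀ) =
        (2⁻¹ : ℝ) • (B * S⁻¹ * Bᵀ) := by
      rw [transpose_smul, Matrix.smul_mul, Matrix.smul_mul, Matrix.mul_smul, smul_smul,
        ← mul_inv, Real.mul_self_sqrt zero_le_two]
    have e2 : ((2⁻¹ : ℝ) • (B * S⁻¹ * Bᵀ))⁻¹ = (2 : ℝ) • (B⁻¹ᵀ * S * B⁻¹) := by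
      refine inv_eq_right_inv ?_
      rw [Matrix.smul_mul, Matrix.mul_smul, smul_smul, inv_mul_cancel₀ two_ne_zero, one_smul]
      have := mul_nonsing_inv (B * S⁻¹ * Bᵀ) (by
        rw [det_mul, det_mul, det_transpose, det_nonsing_inv, Ring.inverse_eq_inv']
        exact (mul_ne_zero (mul_ne_zero hB (inv_ne_zero hd.ne')) hB).isUnit)
      rwa [Matrix.mul_inv_rev, Matrix.mul_inv_rev, nonsing_inv_nonsing_inv _ (Ne.isUnit hd.ne'),
        ← transpose_nonsing_inv, ← Matrix.mul_assoc B⁻¹ᵀ] at this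
    have e3 : (B * Bᵀ * ((2 : ℝ) • (B⁻¹ᵀ * S * B⁻¹))).trace = 2 * S.trace := by
      rw [Matrix.mul_smul, trace_smul, trace_mul_comm, Matrix.mul_assoc, Matrix.mul_assoc,
        nonsing_inv_mul_cancel_left _ _ hB.isUnit, trace_mul_comm, transpose_nonsing_inv,
        mul_nonsing_inv_cancel_right, smul_eq_mul]
      rw [det_transpose]
      exact hB.isUnit
    rw [e1, e2, e3, det_smul, det_mul, det_mul, det_transpose, det_nonsing_inv,
      Ring.inverse_eq_inv', Fintype.card_fin]
    have e4 : (2⁻¹ : ℝ) ^ p * (B.det * S.det⁻¹ * B.det) =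
        ((2 ^ p)⁻¹ * |B.det| ^ 2) * S.det⁻¹ := by rw [sq_abs, inv_pow]; ring
    rw [e4, Real.mul_rpow (by positivity) (by positivity), Real.mul_rpow (by positivity)
      (by positivity), Real.inv_rpow (by positivity), Real.inv_rpow (by positivity),
      ← Real.rpow_natCast, ← Real.rpow_natCast, ← Real.rpow_mul zero_le_two,
      ← Real.rpow_mul (abs_nonneg _), ← Real.rpow_neg zero_le_two, ← Real.rpow_neg hd.le]
    have a1 : -((p : ℝ) * (-m / 2)) = m * p / 2 := by ring
    have a2 : ((2 : ℕ) : ℝ) * (-m / 2) = -m := by push_cast; ring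
    have a3 : -(-m / 2) = m / 2 := by ring
    have a4 : -(1 / 2) * (2 * S.trace) = -S.trace := by ring
    rw [a1, a2, a3, a4]
    ring
  have e' := lintegral_congr_ae e
  simp only [Function.comp_apply]
  rw [e', lintegral_const_mul _ (measurable_gammaIntegrand _ _),
    lintegral_invMeasure_gammaIntegrand p (by linarith), ← ENNReal.ofReal_mul (by positivity),
    det_mul_transpose_rpow, Real.rpow_neg (abs_nonneg _), mul_div_cancel₀ _ two_ne_zero]
  congr 1
  ring

/-! ### Sums of absolute values of minors. -/

/-- The sum of `|det|` over all choices of rows, with repetitions and in any order. -/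
def absDetSum {m q : Type*} [Fintype m] [Fintype q] [DecidableEq q] (M : Matrix m q ℝ) : ℝ :=
  ∑ s : q → m, |(M.submatrix s id).det|

theorem absDetSum_submatrix {m q m' q' : Type*} [Fintype m] [Fintype q] [DecidableEq q]
    [Fintype m'] [Fintype q'] [DecidableEq q'] (M : Matrix m q ℝ) (e : m' ≃ m) (f : q' ≃ q) :
    absDetSum (M.submatrix e f) = absDetSum M := by
  refine Fintype.sum_equiv (Equiv.arrowCongr f e) _ _ fun s => ?_
  rw [← det_submatrix_equiv_self f]
  congr 2
  ext i j
  simp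

/-- Choices with a repeated row contribute 0, and each injective choice is uniquely an increasing
one composed with a permutation, which leaves `|det|` unchanged. Sums over arbitrary choices factor
easily, unlike sums over increasing ones. -/
theorem absDetSum_eq_factorial_mul {N q : ℕ} (M : Matrix (Fin N) (Fin q) ℝ) :
    absDetSum M = (q.factorial : ℝ) * absMinorSum M := by
  have h0 : absDetSum M = ∑ s : {s : Fin q → Fin N // Function.Injective s},
      |(M.submatrix s.1 id).det| := by
    classical
    rw [absDetSum, ← Finset.sum_subtype (Finset.univ.filter Function.Injective) (by simp)
      fun s : Fin q → Fin N => |(M.submatrix s id).det|]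
    refine (Finset.sum_filter_of_ne fun s _ hs i j hij => ?_).symm
    by_contra hne
    exact hs (abs_eq_zero.2 (det_zero_of_row_eq hne (funext fun l => by simp [hij])))
  let g : (Fin q ↪o Fin N) × Equiv.Perm (Fin q) → {s : Fin q → Fin N // Function.Injective s} :=
    fun x => ⟨x.1 ∘ x.2, x.1.injective.comp x.2.injective⟩
  have hg : Function.Bijective g := by
    constructor
    · rintro ⟨e, σ⟩ ⟨e', σ'⟩ h
      have h1 : (e : Fin q → Fin N) ∘ σ = e' ∘ σ' := congrArg Subtype.val h
      have h2 : Set.range e = Set.range e' := by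
        rw [← σ.surjective.range_comp e, ← σ'.surjective.range_comp e', h1]
      have h3 : e = e' := DFunLike.coe_injective
        ((StrictMono.range_inj e.strictMono e'.strictMono).1 h2)
      subst h3
      refine Prod.ext rfl (Equiv.ext fun i => e.injective (congrFun h1 i))
    · rintro ⟨s, hs⟩
      have hm : StrictMono (s ∘ Tuple.sort s) :=
        (Tuple.monotone_sort s).strictMono_of_injective (hs.comp (Tuple.sort s).injective)
      refine ⟨(OrderEmbedding.ofStrictMono _ hm, (Tuple.sort s).symm), Subtype.ext ?_⟩
      ext1 i
      simp [g]
  rw [h0, ← Fintype.sum_bijective g hg (fun x => |(M.submatrix x.1 id).det|) _ fun x => ?_]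
  · rw [Fintype.sum_prod_type, absMinorSum, Finset.mul_sum]
    simp [Fintype.card_perm]
  · have : M.submatrix (g x).1 id = (M.submatrix x.1 id).submatrix x.2 (Equiv.refl _) := rfl
    rw [this, abs_det_submatrix_equiv_equiv]

theorem absMinorSum_square {q : ℕ} (M : Matrix (Fin q) (Fin q) ℝ) : absMinorSum M = |M.det| := by
  have h : ∀ s : Fin q ↪o Fin q, (s : Fin q → Fin q) = id := fun s =>
    (StrictMono.range_inj s.strictMono strictMono_id).1
      ((Finite.injective_iff_surjective.1 s.injective).range_eq.trans
        Function.surjective_id.range_eq.symm)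
  have : Unique (Fin q ↪o Fin q) :=
    ⟨⟨RelEmbedding.refl _⟩, fun s => DFunLike.coe_injective ((h s).trans (h _).symm)⟩
  rw [absMinorSum, Fintype.sum_unique, h, submatrix_id_id]

theorem absMinorSum_mul {N q : ℕ} (M : Matrix (Fin N) (Fin q) ℝ) (B : Matrix (Fin q) (Fin q) ℝ) :
    absMinorSum (M * B) = absMinorSum M * |B.det| := by
  rw [absMinorSum, absMinorSum, Finset.sum_mul]
  refine Finset.sum_congr rfl fun s _ => ?_
  rw [← abs_mul, ← det_mul]
  rfl

theorem absMinorSum_nonneg {N q : ℕ} (M : Matrix (Fin N) (Fin q) ℝ) : 0 ≤ absMinorSum M :=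
  Finset.sum_nonneg fun _ _ => abs_nonneg _

/-- As in the Cauchy–Binet formula, multilinear expansion of `det (Mᵀ M)` in its rows gives only
multiples of maximal minors of `M`. -/
theorem absMinorSum_pos {N q : ℕ} {M : Matrix (Fin N) (Fin q) ℝ} (hM : (Mᵀ * M).det ≠ 0) :
    0 < absMinorSum M := by
  refine (absMinorSum_nonneg M).lt_of_ne fun h => hM ?_
  have h1 : absDetSum M = 0 := by rw [absDetSum_eq_factorial_mul, ← h, mul_zero]
  have h2 : ∀ s : Fin q → Fin N, (M.submatrix s id).det = 0 := fun s =>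
    abs_eq_zero.1 ((Finset.sum_eq_zero_iff_of_nonneg fun _ _ => abs_nonneg _).1 h1 s
      (Finset.mem_univ s))
  have h3 : Mᵀ * M = fun j => ∑ i, M i j • M i := by
    ext j l
    simp [Matrix.mul_apply]
  have h4 := (detRowAlternating (R := ℝ) (n := Fin q)).toMultilinearMap.map_sum
    fun (j : Fin q) (i : Fin N) => M i j • M i
  rw [h3]
  refine h4.trans (Finset.sum_eq_zero fun s _ => ?_)
  refine (det_mul_column (fun j => M (s j) j) (M.submatrix s id)).trans ?_
  rw [h2, mul_zero]

/-- A nonempty sum needs an embedding of the rows. Applied to the data, this gives `p ≤ n` from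
nonsingularity of `S_n`. -/
theorem le_of_absMinorSum_pos {N q : ℕ} {M : Matrix (Fin N) (Fin q) ℝ}
    (hM : 0 < absMinorSum M) : q ≤ N := by
  obtain ⟨s, _, _⟩ := Finset.exists_ne_zero_of_sum_ne_zero hM.ne'
  simpa using Fintype.card_le_of_embedding s.toEmbedding

/-! ### The derivative matrix and its Jacobian under both norms. -/

/-- The matrix `∂w/∂A`, with rows and columns indexed by pairs. -/
def derivBlocks {n p : ℕ} (U : Matrix (Fin n) (Fin p) ℝ) :
    Matrix (Fin n × Fin p) (Fin p × Fin p) ℝ :=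
  Matrix.of fun r c => if r.2 = c.1 then U r.1 c.2 else 0

theorem dataDeriv_eq {n p : ℕ} (u : Fin n → Fin p → ℝ) (A : Matrix (Fin p) (Fin p) ℝ) :
    dataDeriv u A =
      (derivBlocks (Matrix.of u)).submatrix finProdFinEquiv.symm finProdFinEquiv.symm := by
  ext r c
  simp only [dataDeriv, derivBlocks, of_apply, submatrix_apply]
  generalize finProdFinEquiv.symm r = r'
  generalize finProdFinEquiv.symm c = c'
  have h : ∀ t : ℝ, dataGen (A + t • Matrix.single c'.1 c'.2 (1 : ℝ)) u r'.1 r'.2 =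
      dataGen A u r'.1 r'.2 + t * (if r'.2 = c'.1 then u r'.1 c'.2 else 0) := by
    intro t
    simp only [dataGen, add_mulVec, smul_mulVec, Pi.add_apply, Pi.smul_apply, smul_eq_mul]
    congr 2
    rw [single_mulVec]
    simp [Function.update_apply]
  simp only [h]
  rw [deriv_const_add, deriv_mul_const_field, deriv_id'', one_mul]

theorem det_block_eq_prod {p : ℕ} (M : Fin p → Matrix (Fin p) (Fin p) ℝ) :
    (Matrix.of fun r c : Fin p × Fin p => if r.1 = c.1 then M r.1 r.2 c.2 else 0).det =
      ∏ a, (M a).det := by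
  rw [← det_blockDiagonal, ← det_submatrix_equiv_self (Equiv.prodComm _ _)]
  congr 1

-- Row `r` uses observation `i r` and coordinate `k r`. The permutation exists exactly when `k`
-- takes each coordinate `p` times; it then makes the minor block diagonal, and the sum over `i`
-- factors over the blocks. Otherwise every term of the Leibniz expansion contains a zero entry.
open Classical in
theorem sum_abs_det_derivBlocks {n p : ℕ} (U : Matrix (Fin n) (Fin p) ℝ)
    (k : Fin p × Fin p → Fin p) :
    ∑ i : Fin p × Fin p → Fin n, |((derivBlocks U).submatrix (fun r => (i r, k r)) id).det| =
      if ∃ σ : Equiv.Perm (Fin p × Fin p), ∀ r, (σ r).1 = k r then absDetSum U ^ p else 0 := by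
  split_ifs with h
  · obtain ⟨σ, hσ⟩ := h
    have h1 : ∀ i : Fin p × Fin p → Fin n,
        |((derivBlocks U).submatrix (fun r => (i r, k r)) id).det| =
          ∏ a, |(U.submatrix (fun b => i (σ.symm (a, b))) id).det| := by
      intro i
      rw [← Finset.abs_prod, ← det_block_eq_prod,
        ← abs_det_submatrix_equiv_equiv σ.symm (Equiv.refl _)]
      congr 2
      ext ⟨a, b⟩ c
      simp [derivBlocks, ← hσ]
    rw [absDetSum, Fintype.sum_pow]
    refine Fintype.sum_equiv ((Equiv.arrowCongr σ (Equiv.refl _)).trans (Equiv.curry _ _ _)) _ _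
      fun i => ?_
    rw [h1]
    rfl
  · refine Finset.sum_eq_zero fun i _ => ?_
    rw [abs_eq_zero, det_apply]
    refine Finset.sum_eq_zero fun τ _ => ?_
    by_cases hτ : ∀ c, k (τ c) = c.1
    · exact absurd ⟨τ.symm, fun r => by rw [← hτ, Equiv.apply_symm_apply]⟩ h
    · push Not at hτ
      obtain ⟨c, hc⟩ := hτ
      rw [Finset.prod_eq_zero (Finset.mem_univ c), smul_zero]
      simp [derivBlocks, hc]

open Classical in
theorem absDetSum_derivBlocks {n p : ℕ} (U : Matrix (Fin n) (Fin p) ℝ) :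
    absDetSum (derivBlocks U) =
      (Finset.univ.filter fun k : Fin p × Fin p → Fin p =>
        ∃ σ : Equiv.Perm (Fin p × Fin p), ∀ r, (σ r).1 = k r).card * absDetSum U ^ p := by
  rw [absDetSum, ← (Equiv.arrowProdEquivProdArrow _ _ _).symm.sum_comp,
    Fintype.sum_prod_type_right, ← nsmul_eq_mul, ← Finset.sum_const, Finset.sum_filter]
  exact Finset.sum_congr rfl fun k _ => sum_abs_det_derivBlocks U k

/-- The two sides agree up to a combinatorial constant that depends on `p` only. Instead of being
counted, it is read off from the case `n = p` with the identity as data, where both sides are 1. -/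
theorem absMinorSum_dataDeriv {n p : ℕ} (u : Fin n → Fin p → ℝ) (A : Matrix (Fin p) (Fin p) ℝ) :
    absMinorSum (dataDeriv u A) = absMinorSum (Matrix.of u) ^ p := by
  classical
  have key : ∀ {n : ℕ} (u : Fin n → Fin p → ℝ), ((p * p).factorial : ℝ) *
      absMinorSum (dataDeriv u A) = ((Finset.univ.filter fun k : Fin p × Fin p → Fin p =>
        ∃ σ : Equiv.Perm (Fin p × Fin p), ∀ r, (σ r).1 = k r).card * (p.factorial : ℝ) ^ p) *
          absMinorSum (Matrix.of u) ^ p := by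
    intro n u
    rw [← absDetSum_eq_factorial_mul, dataDeriv_eq, absDetSum_submatrix, absDetSum_derivBlocks,
      absDetSum_eq_factorial_mul, mul_pow, mul_assoc]
  let e : Fin p → Fin p → ℝ := fun i j => if i = j then 1 else 0
  have he : Matrix.of e = (1 : Matrix (Fin p) (Fin p) ℝ) := by
    ext i j
    simp [e, Matrix.one_apply]
  have h1 := key e
  have h2 : absMinorSum (dataDeriv e A) = 1 := by
    rw [absMinorSum_square, dataDeriv_eq, abs_det_submatrix_equiv_equiv]
    -- For the identity, `∂w/∂A` is a permutation matrix.
    have : derivBlocks (Matrix.of e) =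
        (1 : Matrix (Fin p × Fin p) _ ℝ).submatrix (Equiv.prodComm _ _) (Equiv.refl _) := by
      ext ⟨a, b⟩ ⟨c, d⟩
      simp only [derivBlocks, e, of_apply, submatrix_apply, Matrix.one_apply,
        Equiv.prodComm_apply, Prod.swap_prod_mk, Equiv.refl_apply, Prod.mk.injEq]
      grind
    rw [this, abs_det_submatrix_equiv_equiv, det_one, abs_one]
  have h3 : absMinorSum (Matrix.of e) = 1 := by
    rw [absMinorSum_square, he, det_one, abs_one]
  rw [h2, h3, one_pow, mul_one, mul_one] at h1
  have h4 := key u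
  rw [← h1] at h4
  exact mul_left_cancel₀ (by positivity) h4

theorem natCast_inv_smul_gram {n p : ℕ} (y : Fin n → Fin p → ℝ) :
    sampleCov y = (n : ℝ)⁻¹ • ((Matrix.of y)ᵀ * Matrix.of y) := by
  rw [sampleCov]
  congr 1
  ext i j
  simp [Matrix.sum_apply, vecMulVec_apply, Matrix.mul_apply]

theorem posSemidef_gram {n p : ℕ} (y : Fin n → Fin p → ℝ) :
    ((Matrix.of y)ᵀ * Matrix.of y).PosSemidef := by
  rw [← conjTranspose_eq_transpose_of_trivial]
  exact posSemidef_conjTranspose_mul_self _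

theorem sampleCov_posSemidef {n p : ℕ} (y : Fin n → Fin p → ℝ) : (sampleCov y).PosSemidef := by
  rw [natCast_inv_smul_gram]
  exact (posSemidef_gram y).smul (by positivity)

theorem of_noiseInv {n p : ℕ} (y : Fin n → Fin p → ℝ) (A : Matrix (Fin p) (Fin p) ℝ) :
    Matrix.of (noiseInv y A) = Matrix.of y * (A⁻¹)ᵀ := by
  ext i j
  simp [noiseInv, Matrix.mul_apply, mulVec, dotProduct, mul_comm]

-- Columns belonging to different rows of `A` have disjoint supports.
open scoped Kronecker in
theorem derivBlocks_gram {n p : ℕ} (U : Matrix (Fin n) (Fin p) ℝ) :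
    (derivBlocks U)ᵀ * derivBlocks U = (1 : Matrix (Fin p) (Fin p) ℝ) ⊗ₖ (Uᵀ * U) := by
  ext ⟨j, l⟩ ⟨j', l'⟩
  simp only [Matrix.mul_apply, transpose_apply, derivBlocks, of_apply, kronecker_apply,
    Fintype.sum_prod_type, Matrix.one_apply]
  by_cases h : j = j'
  · simp [h]
  · simp [h, Ne.symm h]

theorem det_inv_smul_dataDeriv_gram {n p : ℕ} (y : Fin n → Fin p → ℝ)
    (A : Matrix (Fin p) (Fin p) ℝ) :
    ((n : ℝ)⁻¹ • ((dataDeriv (noiseInv y A) A)ᵀ * dataDeriv (noiseInv y A) A)).det =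
      ((sampleCov y).det * |A.det|⁻¹ ^ 2) ^ p := by
  open scoped Kronecker in
  have h : (n : ℝ)⁻¹ • ((dataDeriv (noiseInv y A) A)ᵀ * dataDeriv (noiseInv y A) A) =
      ((1 : Matrix (Fin p) (Fin p) ℝ) ⊗ₖ (A⁻¹ * sampleCov y * (A⁻¹)ᵀ)).submatrix
        finProdFinEquiv.symm finProdFinEquiv.symm := by
    rw [dataDeriv_eq, transpose_submatrix, submatrix_mul_equiv, derivBlocks_gram, of_noiseInv,
      natCast_inv_smul_gram, Matrix.mul_smul, Matrix.smul_mul, kronecker_smul, transpose_mul,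
      transpose_transpose]
    simp only [Matrix.mul_assoc]
    rfl
  rw [h, det_submatrix_equiv_self, det_kronecker, det_one, one_pow, one_mul, Fintype.card_fin,
    det_mul, det_mul, det_transpose, det_nonsing_inv, Ring.inverse_eq_inv', inv_pow, sq_abs]
  ring

/-- In both cases `U = V A⁻ᵀ` pulls out the power of `det A`. Singular `A` are included through the
convention that their inverse is 0. -/
theorem jacobian_eq {n p : ℕ} (ν : NormChoice) (y : Fin n → Fin p → ℝ)
    (A : Matrix (Fin p) (Fin p) ℝ) :
    jacobian ν y A = jacConst ν y * (|A.det| ^ p)⁻¹ := by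
  cases ν with
  | l2 =>
    have hd := (sampleCov_posSemidef y).det_nonneg
    simp only [jacobian, jacD, jacConst]
    rw [det_inv_smul_dataDeriv_gram, abs_of_nonneg hd, mul_pow, Real.sqrt_mul (by positivity),
      ← pow_mul, mul_comm 2 p, pow_mul, Real.sqrt_sq (by positivity), Real.sqrt_eq_rpow,
      ← Real.rpow_natCast, ← Real.rpow_mul hd, inv_pow]
    congr 2
    ring
  | linf =>
    simp only [jacobian, jacD, jacConst]
    rw [absMinorSum_dataDeriv, of_noiseInv, absMinorSum_mul, det_transpose, det_nonsing_inv,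
      Ring.inverse_eq_inv', abs_inv, mul_pow, inv_pow, mul_assoc]

/-! ### The law of the data and the likelihood. -/

theorem measurable_normalDensity {p : ℕ} (S : Matrix (Fin p) (Fin p) ℝ) :
    Measurable (normalDensity S) := by
  refine Measurable.const_mul (Measurable.exp (Measurable.const_mul ?_ _)) _
  exact (continuous_id.dotProduct (continuous_const.matrix_mulVec continuous_id)).measurable

theorem normalDensity_nonneg {p : ℕ} (A : Matrix (Fin p) (Fin p) ℝ) (x : Fin p → ℝ) :
    0 ≤ normalDensity (A * Aᵀ) x := by
  have : 0 ≤ (A * Aᵀ).det := by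
    rw [det_mul, det_transpose]
    exact mul_self_nonneg _
  unfold normalDensity
  positivity

theorem stdNormal_pi_eq (p : ℕ) :
    (Measure.pi fun _ : Fin p => gaussianReal 0 1) =
      (volume : Measure (Fin p → ℝ)).withDensity fun x => ENNReal.ofReal (normalDensity 1 x) := by
  have h1 : gaussianReal 0 1 = volume.withDensity (gaussianPDF 0 1) :=
    gaussianReal_of_var_ne_zero _ one_ne_zero
  have : SigmaFinite (volume.withDensity (gaussianPDF 0 1)) := by
    rw [← h1]
    infer_instance
  rw [h1, pi_withDensity volume (measurable_gaussianPDF 0 1), ← volume_pi]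
  congr 1
  ext1 x
  simp only [gaussianPDF]
  rw [← ENNReal.ofReal_prod_of_nonneg fun i _ => gaussianPDFReal_nonneg _ _ _]
  congr 1
  simp only [gaussianPDFReal]
  rw [Finset.prod_mul_distrib, ← Real.exp_sum, normalDensity]
  simp only [Finset.prod_const, Finset.card_univ, Fintype.card_fin, det_one, Real.one_rpow,
    mul_one, inv_one, one_mulVec, sub_zero, NNReal.coe_one]
  congr 1
  · rw [Real.sqrt_eq_rpow, ← Real.rpow_neg (by positivity), ← Real.rpow_natCast,
      ← Real.rpow_mul (by positivity)]
    congr 1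
    ring
  · rw [dotProduct, Finset.mul_sum]
    congr 1
    refine Finset.sum_congr rfl fun i _ => ?_
    ring

theorem normalDensity_mul_transpose {p : ℕ} (A : Matrix (Fin p) (Fin p) ℝ)
    (x : Fin p → ℝ) : normalDensity (A * Aᵀ) x = |A.det|⁻¹ * normalDensity 1 (A⁻¹ *ᵥ x) := by
  have e : x ⬝ᵥ ((A * Aᵀ)⁻¹ *ᵥ x) = (A⁻¹ *ᵥ x) ⬝ᵥ (A⁻¹ *ᵥ x) := by
    rw [Matrix.mul_inv_rev, ← transpose_nonsing_inv, ← mulVec_mulVec,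
      dotProduct_mulVec, vecMul_transpose]
  rw [normalDensity, normalDensity, e, det_mul_transpose_rpow, det_one, Real.one_rpow, inv_one,
    one_mulVec, show 2 * (-(1 : ℝ) / 2) = -1 by ring, Real.rpow_neg_one]
  ring

theorem map_mulVec_stdNormal {p : ℕ} {A : Matrix (Fin p) (Fin p) ℝ} (hA : A.det ≠ 0) :
    (Measure.pi fun _ : Fin p => gaussianReal 0 1).map (fun z => A *ᵥ z) =
      (volume : Measure (Fin p → ℝ)).withDensity
        fun x => ENNReal.ofReal (normalDensity (A * Aᵀ) x) := by
  have hm : ∀ B : Matrix (Fin p) (Fin p) ℝ, Measurable fun z : Fin p → ℝ => B *ᵥ z :=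
    fun B => (continuous_const.matrix_mulVec continuous_id).measurable
  refine Measure.ext_of_lintegral _ fun F hF => ?_
  have hd := (measurable_normalDensity (1 : Matrix (Fin p) (Fin p) ℝ)).ennreal_ofReal
  rw [lintegral_map hF (hm A), stdNormal_pi_eq,
    lintegral_withDensity_eq_lintegral_mul _ (measurable_normalDensity _).ennreal_ofReal hF]
  refine (lintegral_withDensity_eq_lintegral_mul _ hd (hF.comp (hm A))).trans ?_
  have hG : Measurable fun x : Fin p → ℝ => ENNReal.ofReal (normalDensity 1 (A⁻¹ *ᵥ x)) * F x :=
    (hd.comp (hm A⁻¹)).mul hF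
  have h := lintegral_map (μ := volume) hG
    ((toLin' A).continuous_of_finiteDimensional.measurable)
  rw [Real.map_matrix_volume_pi_eq_smul_volume_pi hA, lintegral_smul_measure] at h
  have e1 : ∀ z : Fin p → ℝ, A⁻¹ *ᵥ toLin' A z = z := by
    intro z
    rw [toLin'_apply, mulVec_mulVec, nonsing_inv_mul _ hA.isUnit, one_mulVec]
  simp only [e1] at h
  refine h.symm.trans ?_
  rw [smul_eq_mul, ← lintegral_const_mul _ hG]
  refine lintegral_congr fun x => ?_
  rw [Pi.mul_apply, normalDensity_mul_transpose, ENNReal.ofReal_mul (by positivity), abs_inv,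
    mul_assoc]

theorem map_dataGen_noiseLaw (n : ℕ) {p : ℕ} {A : Matrix (Fin p) (Fin p) ℝ} (hA : A.det ≠ 0) :
    (noiseLaw n p).map (dataGen A) =
      (volume : Measure (Fin n → Fin p → ℝ)).withDensity
        fun x => ENNReal.ofReal (likelihood x A) := by
  have hm : Measurable fun z : Fin p → ℝ => A *ᵥ z :=
    (continuous_const.matrix_mulVec continuous_id).measurable
  have hprob : IsProbabilityMeasure
      ((Measure.pi fun _ : Fin p => gaussianReal 0 1).map fun z => A *ᵥ z) :=
    Measure.isProbabilityMeasure_map hm.aemeasurable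
  have h := map_mulVec_stdNormal hA
  have hσ : SigmaFinite ((volume : Measure (Fin p → ℝ)).withDensity
      fun x => ENNReal.ofReal (normalDensity (A * Aᵀ) x)) := by
    rw [← h]
    infer_instance
  have h1 := Measure.pi_map_pi (ι := Fin n) (μ := fun _ => Measure.pi fun _ : Fin p =>
    gaussianReal 0 1) (f := fun _ z => A *ᵥ z) (hμ := fun _ => inferInstance)
    fun _ => hm.aemeasurable
  refine h1.trans ?_
  simp only [h]
  rw [pi_withDensity volume (measurable_normalDensity _).ennreal_ofReal, ← volume_pi]
  congr 1
  ext1 x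
  rw [likelihood, ENNReal.ofReal_prod_of_nonneg fun i _ => normalDensity_nonneg _ _]

theorem likelihood_eq {n p : ℕ} (y : Fin n → Fin p → ℝ) (A : Matrix (Fin p) (Fin p) ℝ) :
    likelihood y A = (2 * Real.pi) ^ (-((n : ℝ) * p) / 2) * (|A.det| ^ n)⁻¹ *
      Real.exp (-(1 / 2) * (((Matrix.of y)ᵀ * Matrix.of y) * (A * Aᵀ)⁻¹).trace) := by
  have e : (((Matrix.of y)ᵀ * Matrix.of y) * (A * Aᵀ)⁻¹).trace =
      ∑ i, y i ⬝ᵥ ((A * Aᵀ)⁻¹ *ᵥ y i) := by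
    rw [Matrix.mul_assoc, trace_mul_comm, Matrix.mul_assoc]
    rfl
  rw [likelihood]
  simp only [normalDensity]
  rw [Finset.prod_mul_distrib, ← Real.exp_sum, ← Finset.mul_sum, e, Finset.prod_const,
    Finset.card_univ, Fintype.card_fin, mul_pow, det_mul_transpose_rpow,
    show 2 * (-(1 : ℝ) / 2) = -1 by ring, Real.rpow_neg_one, inv_pow, ← Real.rpow_natCast,
    ← Real.rpow_mul (by positivity),
    show -(p : ℝ) / 2 * (n : ℝ) = -((n : ℝ) * p) / 2 by ring]

/-! ### The fiducial distribution and the law of `A Aᵀ`. -/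

/-- The matrix `n S_n`. -/
def gram {n p : ℕ} (y : Fin n → Fin p → ℝ) : Matrix (Fin p) (Fin p) ℝ :=
  (Matrix.of y)ᵀ * Matrix.of y

theorem pos_of_sampleCov_det_ne_zero {n p : ℕ} (hp : 0 < p) {y : Fin n → Fin p → ℝ}
    (hS : (sampleCov y).det ≠ 0) : 0 < n := by
  refine Nat.pos_of_ne_zero ?_
  rintro rfl
  apply hS
  have : Nonempty (Fin p) := ⟨⟨0, hp⟩⟩
  rw [sampleCov, Nat.cast_zero, _root_.inv_zero, zero_smul, det_zero]

theorem smul_sampleCov {n p : ℕ} (hn : 0 < n) (y : Fin n → Fin p → ℝ) :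
    (n : ℝ) • sampleCov y = gram y := by
  rw [natCast_inv_smul_gram, smul_smul, mul_inv_cancel₀ (by positivity), one_smul, gram]

theorem gram_posDef {n p : ℕ} {y : Fin n → Fin p → ℝ}
    (hS : (sampleCov y).det ≠ 0) : (gram y).PosDef := by
  refine (posSemidef_gram y).posDef_iff_det_ne_zero.2 fun h => hS ?_
  rw [natCast_inv_smul_gram, det_smul, h, mul_zero]

theorem absMinorSum_data_pos {n p : ℕ} {y : Fin n → Fin p → ℝ}
    (hS : (sampleCov y).det ≠ 0) : 0 < absMinorSum (Matrix.of y) :=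
  absMinorSum_pos (gram_posDef hS).det_pos.ne'

theorem jacConst_pos {n p : ℕ} (ν : NormChoice) {y : Fin n → Fin p → ℝ}
    (hS : (sampleCov y).det ≠ 0) : 0 < jacConst ν y := by
  have h1 := absMinorSum_data_pos hS
  have h2 : 0 < n.choose p := Nat.choose_pos (le_of_absMinorSum_pos h1)
  cases ν with
  | l2 => exact Real.rpow_pos_of_pos (abs_pos.2 hS) _
  | linf =>
    simp only [jacConst]
    positivity

/-- The factorization into Haar weight and a function of `A Aᵀ` on which everything rests. -/
theorem ofReal_jacobian_mul_likelihood {n p : ℕ} (hp : 0 < p) (ν : NormChoice)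
    {y : Fin n → Fin p → ℝ} (hS : (sampleCov y).det ≠ 0) (A : Matrix (Fin p) (Fin p) ℝ) :
    ENNReal.ofReal (jacobian ν y A * likelihood y A) =
      ENNReal.ofReal (jacConst ν y * (2 * Real.pi) ^ (-((n : ℝ) * p) / 2)) *
        (haarWeight A * invWishartKernel n (gram y) (A * Aᵀ)) := by
  have hC := jacConst_pos ν hS
  by_cases hA : A.det = 0
  · rw [jacobian_eq, hA, haarWeight_eq_zero hA]
    simp [hp.ne']
  · rw [invWishartKernel, if_pos (posDef_mul_transpose_self hA), jacobian_eq, likelihood_eq,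
      det_mul_transpose_rpow, haarWeight, ← ENNReal.ofReal_mul (by positivity),
      ← ENNReal.ofReal_mul (by positivity), show 2 * (-(n : ℝ) / 2) = -n by ring,
      Real.rpow_neg (abs_nonneg _), Real.rpow_natCast, gram]
    congr 1
    ring

theorem jacobian_mul_likelihood_nonneg {n p : ℕ} (ν : NormChoice)
    {y : Fin n → Fin p → ℝ} (hS : (sampleCov y).det ≠ 0) (A : Matrix (Fin p) (Fin p) ℝ) :
    0 ≤ jacobian ν y A * likelihood y A := by
  have hC := jacConst_pos ν hS
  rw [jacobian_eq, likelihood_eq]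
  positivity

theorem measurable_jacobian_mul_likelihood {n p : ℕ} (ν : NormChoice) (y : Fin n → Fin p → ℝ) :
    Measurable fun A => jacobian ν y A * likelihood y A := by
  simp only [jacobian_eq, likelihood_eq]
  have hd := (measurable_det p).abs
  refine Measurable.mul ((hd.pow_const p).inv.const_mul _)
    (((hd.pow_const n).inv.const_mul _).mul (Measurable.exp (Measurable.const_mul ?_ _)))
  exact (measurable_trace_mul_inv _).comp (measurable_mul_transpose_self p)

theorem lintegral_jacobian_mul_likelihood_comp {n p : ℕ} (hp : 0 < p) (ν : NormChoice)
    {y : Fin n → Fin p → ℝ} (hS : (sampleCov y).det ≠ 0)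
    {F : Matrix (Fin p) (Fin p) ℝ → ℝ≥0∞} (hF : Measurable F) :
    ∫⁻ A, ENNReal.ofReal (jacobian ν y A * likelihood y A) * F (A * Aᵀ) ∂lebesgueMatrix p =
      ENNReal.ofReal (jacConst ν y * (2 * Real.pi) ^ (-((n : ℝ) * p) / 2) *
        (Real.pi ^ ((p : ℝ) ^ 2 / 2) / multiGamma p ((p : ℝ) / 2))) *
          ∫⁻ S, invWishartKernel n (gram y) S * F S ∂invMeasure p := by
  have hC := jacConst_pos ν hS
  have hk := (measurable_invWishartKernel (n : ℝ) (gram y)).mul hF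
  have hm : Measurable fun A : Matrix (Fin p) (Fin p) ℝ =>
      haarWeight A * (invWishartKernel n (gram y) (A * Aᵀ) * F (A * Aᵀ)) :=
    (measurable_haarWeight p).mul (hk.comp (measurable_mul_transpose_self p))
  simp only [ofReal_jacobian_mul_likelihood hp ν hS, mul_assoc (ENNReal.ofReal _),
    mul_assoc (haarWeight _)]
  rw [lintegral_const_mul _ hm]
  have h := lintegral_haarWeight_comp_mul_transpose p hk
  simp only [Pi.mul_apply] at h
  rw [h, ← mul_assoc, ← ENNReal.ofReal_mul (by positivity)]

/-- The closed form of the normalizing constant. -/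
theorem lintegral_jacobian_mul_likelihood {n p : ℕ} (hp : 0 < p) (ν : NormChoice)
    {y : Fin n → Fin p → ℝ} (hS : (sampleCov y).det ≠ 0) :
    ∫⁻ A, ENNReal.ofReal (jacobian ν y A * likelihood y A) ∂lebesgueMatrix p =
      ENNReal.ofReal (Real.pi ^ (((p : ℝ) ^ 2 - (n : ℝ) * p) / 2) * jacConst ν y *
        multiGamma p ((n : ℝ) / 2) /
          ((gram y).det ^ ((n : ℝ) / 2) * multiGamma p ((p : ℝ) / 2))) := by
  have hC := jacConst_pos ν hS
  have hpn : p ≤ n := le_of_absMinorSum_pos (absMinorSum_data_pos hS)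
  have hpn' : (p : ℝ) ≤ n := by exact_mod_cast hpn
  have hg := multiGamma_pos (half_dim_lt (p := p))
  have h := lintegral_jacobian_mul_likelihood_comp hp ν hS (F := fun _ => 1) measurable_const
  simp only [mul_one] at h
  rw [h, lintegral_invWishartKernel (by linarith) (gram_posDef hS),
    ← ENNReal.ofReal_mul (by positivity)]
  congr 1
  rw [Real.mul_rpow zero_le_two Real.pi_pos.le, sub_div, sub_eq_add_neg, Real.rpow_add Real.pi_pos,
    neg_div, Real.rpow_neg zero_le_two]
  have h2 : (0 : ℝ) < 2 ^ ((n : ℝ) * p / 2) := by positivity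
  field_simp

theorem invWishartDensity_eq {p : ℕ} (m : ℝ) {T : Matrix (Fin p) (Fin p) ℝ} (hT : T.PosDef)
    (hg : 0 < multiGamma p (m / 2)) (S : Matrix (Fin p) (Fin p) ℝ) :
    ENNReal.ofReal (invWishartDensity m T S) =
      ENNReal.ofReal (T.det ^ (m / 2) / (2 ^ (m * p / 2) * multiGamma p (m / 2))) *
        (invDensity S * invWishartKernel m T S) := by
  by_cases hS : S.PosDef
  · have hd := hS.det_pos
    have hT' := hT.det_pos
    rw [invWishartDensity, invDensity, invWishartKernel, if_pos hS, if_pos hS, if_pos hS,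
      ← ENNReal.ofReal_mul (by positivity), ← ENNReal.ofReal_mul (by positivity)]
    congr 1
    rw [show -(m + p + 1) / 2 = -((p : ℝ) + 1) / 2 + -m / 2 by ring, Real.rpow_add hd]
    ring
  · rw [invWishartDensity, invDensity, if_neg hS, if_neg hS]
    simp

theorem integrable_jacobian_mul_likelihood {n p : ℕ} (hp : 0 < p) (ν : NormChoice)
    {y : Fin n → Fin p → ℝ} (hS : (sampleCov y).det ≠ 0) :
    Integrable (fun A => jacobian ν y A * likelihood y A) (lebesgueMatrix p) := by
  refine ⟨(measurable_jacobian_mul_likelihood ν y).aestronglyMeasurable, ?_⟩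
  rw [hasFiniteIntegral_iff_ofReal (.of_forall (jacobian_mul_likelihood_nonneg ν hS)),
    lintegral_jacobian_mul_likelihood hp ν hS]
  exact ENNReal.ofReal_lt_top

theorem normalizer_eq {n p : ℕ} (hp : 0 < p) (ν : NormChoice)
    {y : Fin n → Fin p → ℝ} (hS : (sampleCov y).det ≠ 0) :
    0 < normalizer ν y ∧ normalizer ν y =
      Real.pi ^ (((p : ℝ) ^ 2 - (n : ℝ) * p) / 2) * jacConst ν y * multiGamma p ((n : ℝ) / 2) /
        ((gram y).det ^ ((n : ℝ) / 2) * multiGamma p ((p : ℝ) / 2)) := by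
  have hC := jacConst_pos ν hS
  have hpn : (p : ℝ) ≤ n := by exact_mod_cast le_of_absMinorSum_pos (absMinorSum_data_pos hS)
  have h1 := multiGamma_pos (half_dim_lt (p := p))
  have h2 := multiGamma_pos (p := p) (a := (n : ℝ) / 2) (by linarith)
  have h3 := (gram_posDef hS).det_pos
  have h : normalizer ν y =
      Real.pi ^ (((p : ℝ) ^ 2 - (n : ℝ) * p) / 2) * jacConst ν y * multiGamma p ((n : ℝ) / 2) /
        ((gram y).det ^ ((n : ℝ) / 2) * multiGamma p ((p : ℝ) / 2)) := by
    rw [normalizer, integral_eq_lintegral_of_nonneg_ae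
      (.of_forall (jacobian_mul_likelihood_nonneg ν hS))
      (measurable_jacobian_mul_likelihood ν y).aestronglyMeasurable,
      lintegral_jacobian_mul_likelihood hp ν hS, ENNReal.toReal_ofReal (by positivity)]
  refine ⟨?_, h⟩
  rw [h]
  positivity

/-- The factor `C(y)` and the powers of `π` cancel against the normalizing constant, so the law of
`A Aᵀ` does not depend on the norm. -/
theorem lintegral_gfDistribution_comp {n p : ℕ} (hp : 0 < p) (ν : NormChoice)
    {y : Fin n → Fin p → ℝ} (hS : (sampleCov y).det ≠ 0)
    {F : Matrix (Fin p) (Fin p) ℝ → ℝ≥0∞} (hF : Measurable F) :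
    ∫⁻ A, F (A * Aᵀ) ∂gfDistribution ν y =
      ENNReal.ofReal ((gram y).det ^ ((n : ℝ) / 2) /
        (2 ^ ((n : ℝ) * p / 2) * multiGamma p ((n : ℝ) / 2))) *
          ∫⁻ S, invWishartKernel n (gram y) S * F S ∂invMeasure p := by
  obtain ⟨hpos, hnorm⟩ := normalizer_eq hp ν hS
  have hC := jacConst_pos ν hS
  have hpn : (p : ℝ) ≤ n := by exact_mod_cast le_of_absMinorSum_pos (absMinorSum_data_pos hS)
  have h1 := multiGamma_pos (half_dim_lt (p := p))
  have h2 := multiGamma_pos (p := p) (a := (n : ℝ) / 2) (by linarith)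
  have h3 := (gram_posDef hS).det_pos
  have hm := measurable_jacobian_mul_likelihood ν y
  have hF' : Measurable fun A : Matrix (Fin p) (Fin p) ℝ => F (A * Aᵀ) :=
    hF.comp (measurable_mul_transpose_self p)
  have hden : Measurable fun A => ENNReal.ofReal (gfDensity ν y A) :=
    (hm.div_const _).ennreal_ofReal
  rw [gfDistribution, lintegral_withDensity_eq_lintegral_mul _ hden hF']
  have e : ∀ A, ENNReal.ofReal (gfDensity ν y A) = ENNReal.ofReal (normalizer ν y)⁻¹ *
      ENNReal.ofReal (jacobian ν y A * likelihood y A) := by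
    intro A
    rw [gfDensity, div_eq_inv_mul, ENNReal.ofReal_mul (inv_nonneg.2 hpos.le)]
  simp only [Pi.mul_apply, e, mul_assoc (ENNReal.ofReal _)]
  have hm' : Measurable fun A =>
      ENNReal.ofReal (jacobian ν y A * likelihood y A) * F (A * Aᵀ) := hm.ennreal_ofReal.mul hF'
  rw [lintegral_const_mul _ hm', lintegral_jacobian_mul_likelihood_comp hp ν hS hF, ← mul_assoc,
    ← ENNReal.ofReal_mul (inv_nonneg.2 hpos.le), hnorm]
  congr 2
  rw [Real.mul_rpow zero_le_two Real.pi_pos.le, sub_div, sub_eq_add_neg, Real.rpow_add Real.pi_pos,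
    neg_div, Real.rpow_neg zero_le_two]
  have h4 : (0 : ℝ) < 2 ^ ((n : ℝ) * p / 2) := by positivity
  have h5 : (0 : ℝ) < Real.pi ^ (-((n : ℝ) * p / 2)) := by positivity
  field_simp

theorem map_gfDistribution {n p : ℕ} (hp : 0 < p) (ν : NormChoice)
    {y : Fin n → Fin p → ℝ} (hS : (sampleCov y).det ≠ 0) :
    (gfDistribution ν y).map (fun A => A * Aᵀ) = invWishart (n : ℝ) (gram y) := by
  have hpn : (p : ℝ) ≤ n := by exact_mod_cast le_of_absMinorSum_pos (absMinorSum_data_pos hS)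
  have h2 := multiGamma_pos (p := p) (a := (n : ℝ) / 2) (by linarith)
  refine Measure.ext_of_lintegral _ fun F hF => ?_
  have hk := (measurable_invWishartKernel (n : ℝ) (gram y)).mul hF
  have hm : Measurable fun S => invDensity S * (invWishartKernel n (gram y) S * F S) :=
    (measurable_invDensity p).mul hk
  have hden : Measurable fun S => ENNReal.ofReal (invWishartDensity (n : ℝ) (gram y) S) := by
    simp only [invWishartDensity_eq _ (gram_posDef hS) h2]
    exact ((measurable_invDensity p).mul (measurable_invWishartKernel _ _)).const_mul _
  rw [lintegral_map hF (measurable_mul_transpose_self p), lintegral_gfDistribution_comp hp ν hS hF,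
    invWishart, lintegral_withDensity_eq_lintegral_mul _ hden hF]
  simp only [Pi.mul_apply, invWishartDensity_eq _ (gram_posDef hS) h2, mul_assoc]
  rw [lintegral_const_mul _ hm]
  congr 1
  exact lintegral_invMeasure hk

theorem isProbabilityMeasure_gfDistribution {n p : ℕ} (hp : 0 < p) (ν : NormChoice)
    {y : Fin n → Fin p → ℝ} (hS : (sampleCov y).det ≠ 0) :
    IsProbabilityMeasure (gfDistribution ν y) := by
  have hpn : (p : ℝ) ≤ n := by exact_mod_cast le_of_absMinorSum_pos (absMinorSum_data_pos hS)
  have h2 := multiGamma_pos (p := p) (a := (n : ℝ) / 2) (by linarith)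
  have h3 := (gram_posDef hS).det_pos
  have h := lintegral_gfDistribution_comp hp ν hS (F := fun _ => 1) measurable_const
  simp only [mul_one, lintegral_one] at h
  refine ⟨?_⟩
  rw [h, lintegral_invWishartKernel (by linarith) (gram_posDef hS),
    ← ENNReal.ofReal_mul (by positivity), ← ENNReal.ofReal_one]
  congr 1
  have h4 : (0 : ℝ) < 2 ^ ((n : ℝ) * p / 2) := by positivity
  field_simp


end Fiducial

theorem mainTheorem3 (n p : ℕ) (hp : 0 < p) (ν : Fiducial.NormChoice)
    (y : Fin n → Fin p → ℝ) (hS : (Fiducial.sampleCov y).det ≠ 0) :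
    -- `f(·, A)` is the density of the data generated by `Y_i = A Z_i`
    (∀ A : Matrix (Fin p) (Fin p) ℝ, A.det ≠ 0 →
      (Fiducial.noiseLaw n p).map (Fiducial.dataGen A) =
        (volume : Measure (Fin n → Fin p → ℝ)).withDensity
          (fun x => ENNReal.ofReal (Fiducial.likelihood x A))) ∧
    -- the Jacobian
    (∀ A : Matrix (Fin p) (Fin p) ℝ, A.det ≠ 0 →
      Fiducial.jacobian ν y A = Fiducial.jacConst ν y * |A.det| ^ (-(p : ℤ))) ∧
    -- the normalizing constant
    Integrable (fun A => Fiducial.jacobian ν y A * Fiducial.likelihood y A)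
      (Fiducial.lebesgueMatrix p) ∧
    0 < Fiducial.normalizer ν y ∧
    Fiducial.normalizer ν y =
      Real.pi ^ (((p : ℝ) ^ 2 - (n : ℝ) * (p : ℝ)) / 2) * Fiducial.jacConst ν y *
          Fiducial.multiGamma p ((n : ℝ) / 2) /
        (|((n : ℝ) • Fiducial.sampleCov y).det| ^ ((n : ℝ) / 2) *
          Fiducial.multiGamma p ((p : ℝ) / 2)) ∧
    -- the generalized fiducial density of `A`
    (∀ A : Matrix (Fin p) (Fin p) ℝ, A.det ≠ 0 →
      Fiducial.gfDensity ν y A =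
        (Fiducial.normalizer ν y)⁻¹ *
          (Fiducial.jacConst ν y * (2 * Real.pi) ^ (-((n : ℝ) * (p : ℝ)) / 2) *
            |A.det| ^ (-((n : ℤ) + (p : ℤ))) *
            Real.exp (-(1 / 2) *
              (((n : ℝ) • Fiducial.sampleCov y) * (A * Aᵀ)⁻¹).trace))) ∧
    IsProbabilityMeasure (Fiducial.gfDistribution ν y) ∧
    -- the induced distribution of `Σ = A Aᵀ`
    (Fiducial.gfDistribution ν y).map (fun A => A * Aᵀ) =
      Fiducial.invWishart (n : ℝ) ((n : ℝ) • Fiducial.sampleCov y) := by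
  have hn := Fiducial.pos_of_sampleCov_det_ne_zero hp hS
  obtain ⟨hpos, hnorm⟩ := Fiducial.normalizer_eq hp ν hS
  rw [Fiducial.smul_sampleCov hn, abs_of_pos (Fiducial.gram_posDef hS).det_pos]
  refine ⟨fun A hA => Fiducial.map_dataGen_noiseLaw n hA, fun A _ => ?_,
    Fiducial.integrable_jacobian_mul_likelihood hp ν hS, hpos, hnorm, fun A hA => ?_,
    Fiducial.isProbabilityMeasure_gfDistribution hp ν hS, Fiducial.map_gfDistribution hp ν hS⟩
  · rw [Fiducial.jacobian_eq, _root_.zpow_neg, zpow_natCast]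
  · have hd : |A.det| ≠ 0 := abs_ne_zero.2 hA
    rw [Fiducial.gfDensity, Fiducial.jacobian_eq, Fiducial.likelihood_eq, _root_.zpow_neg,
      ← Nat.cast_add, zpow_natCast, pow_add, mul_inv, Fiducial.gram]
    ring
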